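/- Let $d\ge 3$ and $H=\tfrac34$. Let $B=(B^{(1)},\dots,B^{(d)})$ be a $d$-dimensional fractional Brownian motion of Hurst parameter $H$ on a probability space, that is, a centred Gaussian process indexed by $[0,\infty)$ with $$\mathbb E[B^{(i)}_tB^{(j)}_s]=\tfrac{\delta_{ij}}{2}\left(t^{2H}+s^{2H}-|t-s|^{2H}\right).$$ Let $\mathfrak H$ be the Hilbert space completion of the step functions on $[0,\infty)$ for the inner product determined by $\langle \mathbf 1_{[0,s]},\mathbf 1_{[0,t]}\rangle_{\mathfrak H}=\mathbb E[B^{(1)}_sB^{(1)}_t]$. For $f=(f_1,\dots,f_d)\in\mathfrak H^d$ put $B(f)=\sum_{j=1}^d B^{(j)}(f_j)$, where $B^{(j)}:\mathfrak H\to L^2(\Omega)$ is the linear isometry with $B^{(j)}(\mathbf 1_{[0,t]})=B^{(j)}_t$. Let $I_2:(\mathfrak H^d)^{\otimes 2}\to L^2(\Omega)$ be the double Wiener integral, the continuous linear map with $I_2(f\otimes g)=B(f)B(g)-\langle f,g\rangle_{\mathfrak H^d}$ (so $I_2(f\otimes f)=B(f)^2-1$ when $\|f\|=1$). For $\varepsilon>0$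 and $0\le s\le t$ let $f^{\varepsilon}_{2,s,t}\in(\mathfrak H^d)^{\otimes 2}$ be the kernel $$f^{\varepsilon}_{2,s,t}(i_1,i_2,x_1,x_2)=-\frac{(2\pi)^{-d/2}\,\delta_{i_1i_2}}{2}\left(\varepsilon+(t-s)^{2H}\right)^{-\frac d2-1}\mathbf 1_{[s,t]}(x_1)\mathbf 1_{[s,t]}(x_2),\qquad 1\le i_1,i_2\le d,$$ and for $T\ge0$ let $$h^{\varepsilon}_{2,T}=\int_{0\le s\le t\le T}f^{\varepsilon}_{2,s,t}\,ds\,dt .$$ Then $\int_0^\infty(1+u^{3/2})^{-\frac d2-1}u^2\,du<\infty$, and for all $T_1,T_2\ge 0$, $$\lim_{\varepsilon\to0^+}\frac{\varepsilon^{d-2}}{\log(1/\varepsilon)}\,\mathbb E\left[I_2(h^{\varepsilon}_{2,T_1})\,I_2(h^{\varepsilon}_{2,T_2})\right]=\rho^2\,(T_1\wedge T_2),$$ where $$\rho=\frac{\sqrt{3d}}{2^{\frac{d+5}{2}}\pi^{\frac d2}}\int_0^\infty(1+u^{\frac32})^{-\frac d2-1}u^2\,du .$$ -/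

import Mathlib

open MeasureTheory ProbabilityTheory Filter Topology
open scoped NNReal ENNReal TensorProduct

namespace SelfIntersection

noncomputable section

/-- Hurst parameters `H ∈ (0, 1)`. -/
abbrev HurstIndex : Type := Set.Ioo (0 : ℝ) 1

/-- The covariance `(s^{2H} + t^{2H} - |s - t|^{2H}) / 2` of a one-dimensional fractional Brownian
motion. -/
def fbmCov (H s t : ℝ) : ℝ := (s ^ (2 * H) + t ^ (2 * H) - |s - t| ^ (2 * H)) / 2

lemma integrableOn_one_sub_cos (H : HurstIndex) (a : ℝ) :
    IntegrableOn (fun x : ℝ => (1 - Real.cos (a * x)) * x ^ (-1 - 2 * (H : ℝ))) (Set.Ioi 0) := by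
  obtain ⟨H, h0, h1⟩ := H
  simp only
  have hm : AEStronglyMeasurable (fun x : ℝ => (1 - Real.cos (a * x)) * x ^ (-1 - 2 * H))
      (volume.restrict (Set.Ioi 0)) := by
    refine (ContinuousOn.mul (by fun_prop) ?_).aestronglyMeasurable measurableSet_Ioi
    exact ContinuousOn.rpow_const continuousOn_id fun x hx => Or.inl (ne_of_gt hx)
  rw [← Set.Ioc_union_Ioi_eq_Ioi (zero_le_one (α := ℝ)), integrableOn_union]
  constructor
  · have hi : IntegrableOn (fun x : ℝ => a ^ 2 / 2 * x ^ (1 - 2 * H)) (Set.Ioc 0 1) := by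
      refine Integrable.const_mul ?_ _
      have := (intervalIntegral.intervalIntegrable_rpow' (a := 0) (b := 1)
        (r := 1 - 2 * H) (by linarith))
      rwa [intervalIntegrable_iff_integrableOn_Ioc_of_le zero_le_one] at this
    refine Integrable.mono' hi (hm.mono_set Set.Ioc_subset_Ioi_self) ?_
    refine (ae_restrict_mem measurableSet_Ioc).mono fun x hx => ?_
    have hx0 : 0 < x := hx.1
    have hp := Real.rpow_nonneg hx0.le (-1 - 2 * H)
    rw [Real.norm_eq_abs, abs_of_nonneg (mul_nonneg (by linarith [Real.cos_le_one (a * x)]) hp)]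
    have e : x ^ (1 - 2 * H) = x ^ 2 * x ^ (-1 - 2 * H) := by
      rw [← Real.rpow_natCast x 2, ← Real.rpow_add hx0]; norm_num; ring_nf
    rw [e, ← mul_assoc]
    refine mul_le_mul_of_nonneg_right ?_ hp
    have := Real.one_sub_sq_div_two_le_cos (x := a * x)
    nlinarith
  · have hi : IntegrableOn (fun x : ℝ => 2 * x ^ (-1 - 2 * H)) (Set.Ioi 1) :=
      Integrable.const_mul (integrableOn_Ioi_rpow_of_lt (by linarith) one_pos) _
    refine Integrable.mono' hi (hm.mono_set (Set.Ioi_subset_Ioi zero_le_one)) ?_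
    refine (ae_restrict_mem measurableSet_Ioi).mono fun x hx => ?_
    have hx0 : 0 < x := lt_trans one_pos hx
    have hp := Real.rpow_nonneg hx0.le (-1 - 2 * H)
    rw [Real.norm_eq_abs, abs_of_nonneg (mul_nonneg (by linarith [Real.cos_le_one (a * x)]) hp)]
    exact mul_le_mul_of_nonneg_right (by linarith [Real.neg_one_le_cos (a * x)]) hp

lemma exists_spectral (H : HurstIndex) :
    ∃ A : ℝ, 0 < A ∧ ∀ a : ℝ,
      ∫ x in Set.Ioi (0 : ℝ), (1 - Real.cos (a * x)) * x ^ (-1 - 2 * (H : ℝ))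
        = A * |a| ^ (2 * (H : ℝ)) := by
  have h0 : (0 : ℝ) < H := H.2.1
  refine ⟨∫ x in Set.Ioi (0 : ℝ), (1 - Real.cos (1 * x)) * x ^ (-1 - 2 * (H : ℝ)), ?_, ?_⟩
  · rw [setIntegral_pos_iff_support_of_nonneg_ae _ (integrableOn_one_sub_cos H 1)]
    · have hsub : Set.Ioo (0 : ℝ) 1 ⊆ (Function.support fun x : ℝ =>
          (1 - Real.cos (1 * x)) * x ^ (-1 - 2 * (H : ℝ))) ∩ Set.Ioi 0 := by
        rintro x ⟨hx0, hx1⟩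
        refine ⟨?_, hx0⟩
        have h2 : Real.cos x < 1 := by
          rw [← Real.cos_zero]
          exact Real.cos_lt_cos_of_nonneg_of_le_pi le_rfl (by linarith [Real.pi_gt_three]) hx0
        have h3 := Real.rpow_pos_of_pos hx0 (-1 - 2 * (H : ℝ))
        rw [Function.mem_support, one_mul]
        exact (mul_pos (by linarith) h3).ne'
      refine lt_of_lt_of_le ?_ (measure_mono hsub)
      simp
    · refine (ae_restrict_mem measurableSet_Ioi).mono fun x hx => ?_
      exact mul_nonneg (by linarith [Real.cos_le_one (1 * x)]) (Real.rpow_nonneg (le_of_lt hx) _)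
  · intro a
    rcases eq_or_ne a 0 with rfl | ha
    · simp [Real.zero_rpow (by positivity : (2 * (H : ℝ)) ≠ 0)]
    have hb : 0 < |a| := abs_pos.mpr ha
    have hcv := integral_comp_mul_left_Ioi
      (fun x : ℝ => (1 - Real.cos (1 * x)) * x ^ (-1 - 2 * (H : ℝ))) 0 hb
    rw [mul_zero, smul_eq_mul] at hcv
    have : ∫ x in Set.Ioi (0 : ℝ), (1 - Real.cos (1 * (|a| * x))) * (|a| * x) ^ (-1 - 2 * (H : ℝ))
        = |a| ^ (-1 - 2 * (H : ℝ)) *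
          ∫ x in Set.Ioi (0 : ℝ), (1 - Real.cos (a * x)) * x ^ (-1 - 2 * (H : ℝ)) := by
      rw [← integral_const_mul]
      refine setIntegral_congr_fun measurableSet_Ioi fun x hx => ?_
      have hx0 : (0 : ℝ) < x := hx
      have hc : Real.cos (1 * (|a| * x)) = Real.cos (a * x) := by
        rw [one_mul, ← Real.cos_abs (a * x), abs_mul, abs_of_pos hx0]
      rw [hc, Real.mul_rpow hb.le hx0.le]; ring
    rw [this] at hcv
    have e1 : |a| ^ (-1 - 2 * (H : ℝ)) * (|a| ^ (2 * (H : ℝ)) * |a|) = 1 := by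
      nth_rewrite 3 [← Real.rpow_one |a|]
      rw [← Real.rpow_add hb, ← Real.rpow_add hb]; ring_nf; simp
    set J := ∫ x in Set.Ioi (0 : ℝ), (1 - Real.cos (a * x)) * x ^ (-1 - 2 * (H : ℝ))
    set A := ∫ x in Set.Ioi (0 : ℝ), (1 - Real.cos (1 * x)) * x ^ (-1 - 2 * (H : ℝ))
    calc J = (|a| ^ (-1 - 2 * (H : ℝ)) * J) * (|a| ^ (2 * (H : ℝ)) * |a|) := by
            linear_combination (-J) * e1
      _ = A * |a| ^ (2 * (H : ℝ)) := by rw [hcv]; field_simp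

/-- The fractional covariance is positive semidefinite (needed to have an inner product). -/
lemma fbmCov_posSemidef (H : HurstIndex) (c : ℝ≥0 →₀ ℝ) :
    0 ≤ c.sum fun s a => c.sum fun t b => a * b * fbmCov H s t := by
  obtain ⟨A, hA, hJ⟩ := exists_spectral H
  have iw := integrableOn_one_sub_cos H
  set w : ℝ → ℝ := fun x => x ^ (-1 - 2 * (H : ℝ)) with hw
  replace iw : ∀ a : ℝ, IntegrableOn (fun x : ℝ => (1 - Real.cos (a * x)) * w x) (Set.Ioi 0) := iw
  replace hJ : ∀ a : ℝ, ∫ x in Set.Ioi (0 : ℝ), (1 - Real.cos (a * x)) * w x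
      = A * |a| ^ (2 * (H : ℝ)) := hJ
  have key : ∀ s t : ℝ≥0, 2 * A * fbmCov H s t = ∫ x in Set.Ioi (0 : ℝ),
      ((1 - Real.cos (s * x)) * (1 - Real.cos (t * x)) + Real.sin (s * x) * Real.sin (t * x)) * w x
      := by
    intro s t
    have i1 := iw s
    have i2 := iw t
    have i3 := iw ((s : ℝ) - t)
    have : ∀ x : ℝ, ((1 - Real.cos (s * x)) * (1 - Real.cos (t * x))
        + Real.sin (s * x) * Real.sin (t * x)) * w x
        = (1 - Real.cos (s * x)) * w x + (1 - Real.cos (t * x)) * w x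
          - (1 - Real.cos (((s : ℝ) - t) * x)) * w x := by
      intro x
      rw [sub_mul (s : ℝ), Real.cos_sub]; ring
    simp_rw [this]
    have e1 := integral_sub (i1.add i2) i3
    have e2 := integral_add i1 i2
    simp only [Pi.add_apply] at e1
    rw [e1, e2, hJ, hJ, hJ, fbmCov, NNReal.abs_eq,
      NNReal.abs_eq]
    ring
  have hint : ∀ s t : ℝ≥0, IntegrableOn (fun x : ℝ =>
      ((1 - Real.cos (s * x)) * (1 - Real.cos (t * x)) + Real.sin (s * x) * Real.sin (t * x)) * w x)
      (Set.Ioi 0) := by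
    intro s t
    have := ((iw s).add (iw t)).sub (iw ((s : ℝ) - t))
    refine this.congr (Eventually.of_forall fun x => ?_)
    simp only [Pi.add_apply, Pi.sub_apply]
    rw [sub_mul (s : ℝ), Real.cos_sub]; ring
  have : 2 * A * (c.sum fun s a => c.sum fun t b => a * b * fbmCov H s t)
      = ∫ x in Set.Ioi (0 : ℝ), ((c.sum fun s a => a * (1 - Real.cos (s * x))) ^ 2
        + (c.sum fun s a => a * Real.sin (s * x)) ^ 2) * w x := by
    have e : ∀ x : ℝ, ((c.sum fun s a => a * (1 - Real.cos (s * x))) ^ 2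
        + (c.sum fun s a => a * Real.sin (s * x)) ^ 2) * w x
        = ∑ s ∈ c.support, ∑ t ∈ c.support, c s * c t *
          (((1 - Real.cos (s * x)) * (1 - Real.cos (t * x))
            + Real.sin (s * x) * Real.sin (t * x)) * w x) := by
      intro x
      simp only [Finsupp.sum, sq]
      rw [Finset.sum_mul_sum, Finset.sum_mul_sum, ← Finset.sum_add_distrib, Finset.sum_mul]
      refine Finset.sum_congr rfl fun s _ => ?_
      rw [← Finset.sum_add_distrib, Finset.sum_mul]
      refine Finset.sum_congr rfl fun t _ => ?_
      ring
    simp_rw [e]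
    rw [integral_finsetSum _ fun s _ => integrable_finsetSum _ fun t _ =>
      (hint s t).const_mul _]
    simp only [Finsupp.sum, Finset.mul_sum]
    refine Finset.sum_congr rfl fun s _ => ?_
    rw [integral_finsetSum _ fun t _ => (hint s t).const_mul _]
    refine Finset.sum_congr rfl fun t _ => ?_
    rw [integral_const_mul, ← key]; ring
  have h2 : 0 ≤ 2 * A * (c.sum fun s a => c.sum fun t b => a * b * fbmCov H s t) := by
    rw [this]
    refine setIntegral_nonneg measurableSet_Ioi fun x hx => ?_
    exact mul_nonneg (by positivity) (Real.rpow_nonneg (le_of_lt hx) _)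
  exact nonneg_of_mul_nonneg_right h2 (by positivity)

/-- Real step functions on `[0, ∞)`, written in the basis of indicators of `[0, t]`, `t ≥ 0`: the
finitely supported family `c` stands for the function `∑ t, c t • 1_{[0, t]}`. -/
def StepFun (_H : HurstIndex) : Type := ℝ≥0 →₀ ℝ

namespace StepFun
variable {H : HurstIndex}

instance : AddCommGroup (StepFun H) := inferInstanceAs (AddCommGroup (ℝ≥0 →₀ ℝ))
instance : Module ℝ (StepFun H) := inferInstanceAs (Module ℝ (ℝ≥0 →₀ ℝ))

/-- The indicator function of `[0, t]`. -/
def ind (t : ℝ≥0) : StepFun H := Finsupp.single t (1 : ℝ)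

/-- The inner product `⟨f, g⟩ = ∑ s, ∑ t, f s * g t * fbmCov H s t` on step functions, that is, the
bilinear form with `⟨1_{[0, s]}, 1_{[0, t]}⟩ = fbmCov H s t`. It may be degenerate. -/
@[reducible] def core (H : HurstIndex) : PreInnerProductSpace.Core ℝ (StepFun H) where
  inner f g := Finsupp.sum (M := ℝ) f fun s a => Finsupp.sum (M := ℝ) g fun t b =>
    a * b * fbmCov H s t
  conj_inner_symm f g := by
    simp only [conj_trivial, Finsupp.sum]
    rw [Finset.sum_comm]
    refine Finset.sum_congr rfl fun s _ => Finset.sum_congr rfl fun t _ => ?_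
    simp only [fbmCov]
    rw [abs_sub_comm]; ring
  re_inner_nonneg f := fbmCov_posSemidef H f
  add_left f g h := by
    refine Finsupp.sum_add_index' (h := fun (s : ℝ≥0) (a : ℝ) => Finsupp.sum (M := ℝ) h fun t b =>
      a * b * fbmCov H s t) (fun s => by simp [Finsupp.sum]) fun s a b => ?_
    simp only [Finsupp.sum, ← Finset.sum_add_distrib]
    exact Finset.sum_congr rfl fun t _ => by ring
  smul_left f g r := by
    refine (Finsupp.sum_smul_index' (h := fun (s : ℝ≥0) (a : ℝ) => Finsupp.sum (M := ℝ) g fun t b =>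
      a * b * fbmCov H s t) (fun s => by simp [Finsupp.sum])).trans ?_
    simp only [Finsupp.sum, Finset.mul_sum, conj_trivial, smul_eq_mul]
    exact Finset.sum_congr rfl fun s _ => Finset.sum_congr rfl fun t _ => by ring

instance : SeminormedAddCommGroup (StepFun H) :=
  InnerProductSpace.Core.toSeminormedAddCommGroup (c := core H)

instance : InnerProductSpace ℝ (StepFun H) := InnerProductSpace.ofCore (core H)

lemma inner_def (f g : StepFun H) : inner ℝ f g =
    Finsupp.sum (M := ℝ) f fun s a => Finsupp.sum (M := ℝ) g fun t b => a * b * fbmCov H s t := rfl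

lemma inner_ind_ind (s t : ℝ≥0) :
    inner ℝ (ind s : StepFun H) (ind t) = fbmCov H s t := by
  rw [inner_def, ind, ind]
  refine (Finsupp.sum_single_index (by simp)).trans ?_
  refine (Finsupp.sum_single_index (by simp)).trans ?_
  simp

end StepFun

/-- The Hilbert space `𝔥`: the completion of the step functions (vectors of norm zero are
identified with zero by the completion). -/
abbrev HSpace (H : HurstIndex) : Type := UniformSpace.Completion (StepFun H)
/-- The Hilbert space `𝔥^d`. -/
abbrev HSpacePow (H : HurstIndex) (d : ℕ) : Type := PiLp 2 fun _ : Fin d => HSpace H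
/-- The Hilbert space tensor product `(𝔥^d)^{⊗ 2}`: the completion of the algebraic tensor square
for the inner product `⟨f ⊗ g, h ⊗ k⟩ = ⟨f, h⟩ ⟨g, k⟩`. -/
abbrev HSpaceTensor (H : HurstIndex) (d : ℕ) : Type :=
  UniformSpace.Completion (HSpacePow H d ⊗[ℝ] HSpacePow H d)

variable {Ω : Type*} [MeasurableSpace Ω]

/-- `B` is a `d`-dimensional fractional Brownian motion of Hurst parameter `H` under `P`: a centred
`ℝ^d`-valued Gaussian process with `E[B_t^i B_s^j] = δ_{ij} fbmCov H t s`. -/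
structure IsFBM (H : HurstIndex) {d : ℕ} (B : ℝ≥0 → Ω → EuclideanSpace ℝ (Fin d))
    (P : Measure Ω) : Prop where
  gaussian : IsGaussianProcess B P
  centered : ∀ t i, ∫ ω, B t ω i ∂P = 0
  covariance : ∀ s t i j, ∫ ω, B t ω i * B s ω j ∂P = if i = j then fbmCov H t s else 0

variable {H : HurstIndex} {d : ℕ} {B : ℝ≥0 → Ω → EuclideanSpace ℝ (Fin d)} {P : Measure Ω}

namespace IsFBM

lemma memLp (hB : IsFBM H B P) (j : Fin d) (t : ℝ≥0) : MemLp (fun ω => B t ω j) 2 P :=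
  ((hB.gaussian.hasGaussianLaw_eval t).map_fun (EuclideanSpace.proj j)).memLp_two

/-- The linear map `1_{[0, t]} ↦ B_t^{(j)}` from step functions to `L²(Ω)`. -/
def wienerStep (hB : IsFBM H B P) (j : Fin d) : StepFun H →ₗ[ℝ] Lp ℝ 2 P :=
  Finsupp.linearCombination ℝ fun t => (hB.memLp j t).toLp

lemma wienerStep_apply (hB : IsFBM H B P) (j : Fin d) (f : StepFun H) :
    hB.wienerStep j f = Finsupp.sum (M := ℝ) f fun t a => a • (hB.memLp j t).toLp := rfl

/-- The isometry `f ↦ B^{(j)}(f)` from `𝔥` to `L²(Ω)`, the continuous extension of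
`1_{[0, t]} ↦ B_t^{(j)}`. -/
def wiener₁ (hB : IsFBM H B P) (j : Fin d) : HSpace H →L[ℝ] Lp ℝ 2 P :=
  (hB.wienerStep j).extendOfNorm (UniformSpace.Completion.toComplL (𝕜 := ℝ)).toLinearMap

/-- The isometry `f ↦ B(f) = ∑ j, B^{(j)}(f_j)` from `𝔥^d` to `L²(Ω)`. -/
def wiener (hB : IsFBM H B P) : HSpacePow H d →L[ℝ] Lp ℝ 2 P :=
  ∑ j, (hB.wiener₁ j).comp (PiLp.proj 2 (fun _ : Fin d => HSpace H) j)

lemma inner_wienerStep (hB : IsFBM H B P) (i j : Fin d) (f g : StepFun H) :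
    inner ℝ (hB.wienerStep i f) (hB.wienerStep j g) = if i = j then inner ℝ f g else 0 := by
  have key : ∀ s t, inner ℝ (hB.memLp i s).toLp (hB.memLp j t).toLp =
      if i = j then fbmCov H s t else 0 := by
    intro s t
    rw [← hB.covariance t s i j, L2.inner_def]
    refine integral_congr_ae ?_
    filter_upwards [(hB.memLp i s).coeFn_toLp, (hB.memLp j t).coeFn_toLp] with ω h1 h2
    rw [h1, h2]; simp [mul_comm]
  rw [StepFun.inner_def, wienerStep_apply, wienerStep_apply]
  simp only [Finsupp.sum, sum_inner, inner_sum, inner_smul_left, inner_smul_right, key]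
  split_ifs
  · simp only [Finset.mul_sum]
    rw [Finset.sum_comm]
    exact Finset.sum_congr rfl fun s _ => Finset.sum_congr rfl fun t _ => by
      simp only [conj_trivial]; ring
  · simp

lemma norm_wienerStep (hB : IsFBM H B P) (j : Fin d) (f : StepFun H) :
    ‖hB.wienerStep j f‖ = ‖f‖ := by
  rw [← sq_eq_sq₀ (norm_nonneg _) (norm_nonneg _), ← real_inner_self_eq_norm_sq,
    ← real_inner_self_eq_norm_sq, inner_wienerStep, if_pos rfl]

lemma wiener₁_coe (hB : IsFBM H B P) (j : Fin d) (f : StepFun H) :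
    hB.wiener₁ j (f : HSpace H) = hB.wienerStep j f := by
  have hd : DenseRange (UniformSpace.Completion.toComplL (𝕜 := ℝ) (E := StepFun H)).toLinearMap :=
    UniformSpace.Completion.denseRange_coe
  refine LinearMap.extendOfNorm_eq (f := hB.wienerStep j) hd ⟨1, fun x => ?_⟩ f
  rw [hB.norm_wienerStep, one_mul]
  exact (UniformSpace.Completion.norm_coe x).ge

lemma inner_wiener₁ (hB : IsFBM H B P) (i j : Fin d) (f g : HSpace H) :
    inner ℝ (hB.wiener₁ i f) (hB.wiener₁ j g) = if i = j then inner ℝ f g else 0 := by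
  refine UniformSpace.Completion.induction_on₂ f g ?_ fun f g => ?_
  · refine isClosed_eq (by fun_prop) ?_
    split_ifs <;> fun_prop
  · rw [wiener₁_coe, wiener₁_coe, inner_wienerStep, UniformSpace.Completion.inner_coe]

lemma wiener_apply (hB : IsFBM H B P) (f : HSpacePow H d) :
    hB.wiener f = ∑ j, hB.wiener₁ j (f j) := by
  simp [wiener]

lemma inner_wiener (hB : IsFBM H B P) (f g : HSpacePow H d) :
    inner ℝ (hB.wiener f) (hB.wiener g) = inner ℝ f g := by
  simp [wiener_apply, sum_inner, inner_sum, inner_wiener₁, PiLp.inner_apply]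

lemma isProbabilityMeasure (hB : IsFBM H B P) : IsProbabilityMeasure P :=
  hB.gaussian.isProbabilityMeasure

lemma continuous_integral_exp [IsProbabilityMeasure P] (t : ℝ) :
    Continuous fun X : Lp ℝ 2 P => ∫ ω, Complex.exp (t * X ω * Complex.I) ∂P := by
  have hi : ∀ X : Lp ℝ 2 P, Integrable (fun ω => Complex.exp (t * X ω * Complex.I)) P := by
    intro X
    refine Integrable.of_bound (C := 1) ?_ (Eventually.of_forall fun ω => ?_)
    · have := (Lp.aestronglyMeasurable X).aemeasurable
      exact AEMeasurable.aestronglyMeasurable (by fun_prop)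
    · rw [← Complex.ofReal_mul, Complex.norm_exp_ofReal_mul_I]
  have hl : LipschitzWith (Real.toNNReal |t|)
      fun X : Lp ℝ 2 P => ∫ ω, Complex.exp (t * X ω * Complex.I) ∂P := by
    refine LipschitzWith.of_dist_le_mul fun X Y => ?_
    rw [dist_eq_norm, dist_eq_norm, ← integral_sub (hi X) (hi Y),
      Real.coe_toNNReal _ (abs_nonneg t)]
    have hsub : MemLp (fun ω => X ω - Y ω) 2 P := (Lp.memLp X).sub (Lp.memLp Y)
    have h1 : ∫ ω, ‖X ω - Y ω‖ ∂P ≤ ‖X - Y‖ := by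
      rw [Lp.norm_def, eLpNorm_congr_ae (Lp.coeFn_sub X Y),
        integral_norm_eq_lintegral_enorm hsub.1]
      refine ENNReal.toReal_mono hsub.2.ne ?_
      rw [← eLpNorm_one_eq_lintegral_enorm]
      exact eLpNorm_le_eLpNorm_of_exponent_le (by norm_num) hsub.1
    refine (norm_integral_le_integral_norm _).trans ?_
    refine le_trans (integral_mono_of_nonneg (g := fun ω => |t| * ‖X ω - Y ω‖)
      (Eventually.of_forall fun ω => norm_nonneg _)
      ((hsub.integrable (by norm_num)).norm.const_mul _) (Eventually.of_forall fun ω => ?_)) ?_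
    · have e : Complex.exp (t * X ω * Complex.I) - Complex.exp (t * Y ω * Complex.I)
          = Complex.exp ((t * Y ω : ℝ) * Complex.I)
            * (Complex.exp (Complex.I * (t * (X ω - Y ω) : ℝ)) - 1) := by
        rw [mul_sub, ← Complex.exp_add]
        push_cast
        ring_nf
      simp only
      rw [e, norm_mul, Complex.norm_exp_ofReal_mul_I, one_mul]
      exact Real.norm_exp_I_mul_ofReal_sub_one_le.trans (by rw [norm_mul, Real.norm_eq_abs t])
    · rw [integral_const_mul]
      exact mul_le_mul_of_nonneg_left h1 (abs_nonneg t)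
  exact hl.continuous

lemma map_sum_wienerStep (hB : IsFBM H B P) (c : Fin d → StepFun H) :
    HasGaussianLaw (∑ j, hB.wienerStep j (c j) : Lp ℝ 2 P) P ∧
      ∫ ω, (∑ j, hB.wienerStep j (c j) : Lp ℝ 2 P) ω ∂P = 0 := by
  classical
  let c' : Fin d → ℝ≥0 →₀ ℝ := c
  have hP := hB.isProbabilityMeasure
  have h1 : IsGaussianProcess (fun (p : Fin d × ℝ≥0) ω => c' p.1 p.2 • B p.2 ω p.1) P := by
    refine hB.gaussian.of_isGaussianProcess fun p => ⟨{p.2},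
      c' p.1 p.2 • (EuclideanSpace.proj p.1).comp (ContinuousLinearMap.proj ⟨p.2, by simp⟩), ?_⟩
    intro ω
    simp
  let I : Finset (Fin d × ℝ≥0) := Finset.univ.biUnion fun j => (c' j).support.image fun t => (j, t)
  have h2 := h1.hasGaussianLaw_fun_sum (I := I)
  have hI : ∀ g : Fin d → ℝ≥0 → ℝ, ∑ p ∈ I, g p.1 p.2 = ∑ j, ∑ t ∈ (c' j).support, g j t := by
    intro g
    rw [Finset.sum_biUnion]
    · refine Finset.sum_congr rfl fun j _ => ?_
      rw [Finset.sum_image]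
      intro a _ b _ h
      exact (Prod.mk.inj h).2
    · intro i _ j _ hij
      simp only [Function.onFun, Finset.disjoint_left, Finset.mem_image]
      rintro _ ⟨a, _, rfl⟩ ⟨b, _, h⟩
      exact hij (Prod.mk.inj h).1.symm
  have h3 : (fun ω => ∑ p ∈ I, c' p.1 p.2 • B p.2 ω p.1)
      =ᵐ[P] (∑ j, hB.wienerStep j (c j) : Lp ℝ 2 P) := by
    have e1 := Lp.coeFn_fun_finsetSum (μ := P) Finset.univ fun j => hB.wienerStep j (c j)
    have e2 : ∀ j, hB.wienerStep j (c j) =ᵐ[P] fun ω => ∑ t ∈ (c' j).support, c' j t * B t ω j := by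
      intro j
      have e3 := Lp.coeFn_fun_finsetSum (μ := P) (c' j).support fun t => c' j t • (hB.memLp j t).toLp
      have e4 : ∀ t ∈ (c' j).support, ∀ᵐ ω ∂P,
          (c' j t • (hB.memLp j t).toLp : Lp ℝ 2 P) ω = c' j t * B t ω j := by
        intro t _
        filter_upwards [Lp.coeFn_smul (c' j t) (hB.memLp j t).toLp, (hB.memLp j t).coeFn_toLp]
          with ω h1 h2
        rw [h1, Pi.smul_apply, h2, smul_eq_mul]
      rw [← Finset.eventually_all] at e4
      rw [wienerStep_apply]
      filter_upwards [e3, e4] with ω h3 h4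
      refine h3.trans (Finset.sum_congr rfl h4)
    filter_upwards [e1, eventually_all.2 e2] with ω h1 h2
    rw [h1, hI fun j t => c' j t • B t ω j]
    exact (Finset.sum_congr rfl fun j _ => h2 j).symm
  refine ⟨h2.congr h3, ?_⟩
  rw [← integral_congr_ae h3, integral_finsetSum]
  · simp [integral_const_mul, hB.centered]
  · intro p _
    exact ((hB.memLp p.1 p.2).integrable (by norm_num)).const_mul _

lemma integral_sq (X : Lp ℝ 2 P) : ∫ ω, X ω ^ 2 ∂P = ‖X‖ ^ 2 := by
  rw [← real_inner_self_eq_norm_sq, L2.inner_def]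
  simp [sq]

/-- For every element of the Hilbert space, its Wiener integral is a centred Gaussian variable
whose variance is the squared norm of the integrand. -/
lemma map_wiener (hB : IsFBM H B P) (f : HSpacePow H d) :
    P.map (hB.wiener f) = gaussianReal 0 (‖f‖₊ ^ 2) := by
  have hP := hB.isProbabilityMeasure
  have hm : ∀ X : Lp ℝ 2 P, AEMeasurable X P := fun X =>
    (Lp.aestronglyMeasurable X).aemeasurable
  have : IsProbabilityMeasure (P.map (hB.wiener f)) := Measure.isProbabilityMeasure_map (hm _)
  refine Measure.ext_of_charFun (funext fun t => ?_)
  have hcf : ∀ X : Lp ℝ 2 P, charFun (P.map X) t = ∫ ω, Complex.exp (t * X ω * Complex.I) ∂P := by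
    intro X
    rw [charFun_apply_real, integral_map (hm X)]
    exact Continuous.aestronglyMeasurable (by fun_prop)
  rw [hcf, charFun_gaussianReal]
  have hd : DenseRange fun c : Fin d → StepFun H =>
      (WithLp.toLp 2 fun j => (c j : HSpace H) : HSpacePow H d) :=
    (PiLp.homeomorph 2 (fun _ : Fin d => HSpace H)).symm.surjective.denseRange.comp
      (DenseRange.piMap fun _ => UniformSpace.Completion.denseRange_coe)
      (PiLp.homeomorph 2 (fun _ : Fin d => HSpace H)).symm.continuous
  refine hd.induction_on (p := fun f => ∫ ω, Complex.exp (t * hB.wiener f ω * Complex.I) ∂P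
    = Complex.exp (t * (0 : ℝ) * Complex.I - (‖f‖₊ ^ 2 : ℝ≥0) * t ^ 2 / 2)) f ?_ ?_
  · refine isClosed_eq ((continuous_integral_exp t).comp hB.wiener.continuous) ?_
    fun_prop
  · intro c
    set f : HSpacePow H d := WithLp.toLp 2 fun j => (c j : HSpace H) with hf
    have hw : hB.wiener f = ∑ j, hB.wienerStep j (c j) := by
      rw [wiener_apply]
      exact Finset.sum_congr rfl fun j _ => hB.wiener₁_coe j (c j)
    obtain ⟨hg, h0⟩ := hB.map_sum_wienerStep c
    rw [← hw] at hg h0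
    rw [← hcf, hg.map_eq_gaussianReal, charFun_gaussianReal, h0]
    have hv : Var[hB.wiener f; P].toNNReal = ‖f‖₊ ^ 2 := by
      rw [variance_of_integral_eq_zero (hm _) h0, integral_sq, ← real_inner_self_eq_norm_sq,
        inner_wiener, real_inner_self_eq_norm_sq]
      ext
      simp
    rw [hv]

lemma integral_pow_four_gaussianReal (v : ℝ≥0) :
    ∫ x, x ^ 4 ∂(gaussianReal 0 v) = 3 * (v : ℝ) ^ 2 := by
  rcases eq_or_ne v 0 with rfl | hv
  · simp
  have hv' : (0 : ℝ) < v := by positivity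
  rw [integral_gaussianReal_eq_integral_smul hv]
  have h1 : ∀ x : ℝ, gaussianPDFReal 0 v x • x ^ 4
      = (√(2 * Real.pi * v))⁻¹ * (fun y : ℝ => y ^ (4 : ℝ) *
        Real.exp (-(2 * (v : ℝ))⁻¹ * y ^ (2 : ℝ))) |x| := by
    intro x
    simp only [gaussianPDFReal, smul_eq_mul, sub_zero]
    rw [show (4 : ℝ) = ((4 : ℕ) : ℝ) by norm_num, show (2 : ℝ) = ((2 : ℕ) : ℝ) by norm_num,
      Real.rpow_natCast, Real.rpow_natCast, sq_abs, (by decide : Even 4).pow_abs]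
    rw [show -((((2 : ℕ) : ℝ) * (v : ℝ))⁻¹) * x ^ 2 = -x ^ 2 / (((2 : ℕ) : ℝ) * v) by
      field_simp]
    ring
  simp_rw [h1]
  rw [integral_const_mul, integral_comp_abs (f := fun y : ℝ => y ^ (4 : ℝ) *
        Real.exp (-(2 * (v : ℝ))⁻¹ * y ^ (2 : ℝ))),
    integral_rpow_mul_exp_neg_mul_rpow (by norm_num) (by norm_num) (by positivity)]
  have hG : Real.Gamma ((4 + 1) / 2) = 3 / 4 * √Real.pi := by
    rw [show ((4 : ℝ) + 1) / 2 = 1 / 2 + 1 + 1 by norm_num, Real.Gamma_add_one (by norm_num),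
      Real.Gamma_add_one (by norm_num), Real.Gamma_one_half_eq]
    ring
  have hp : ((2 * (v : ℝ))⁻¹) ^ (-((4 : ℝ) + 1) / 2) = (2 * v) ^ 2 * √(2 * v) := by
    rw [Real.inv_rpow (by positivity), ← Real.rpow_neg (by positivity),
      show -(-((4 : ℝ) + 1) / 2) = 2 + 1 / 2 by norm_num, Real.rpow_add (by positivity),
      ← Real.sqrt_eq_rpow]
    norm_num
  rw [hG, hp, show 2 * Real.pi * (v : ℝ) = Real.pi * (2 * v) by ring,
    Real.sqrt_mul Real.pi_pos.le]
  have := Real.sqrt_pos.mpr Real.pi_pos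
  have := Real.sqrt_pos.mpr (show (0 : ℝ) < 2 * v by positivity)
  field_simp
  ring

lemma hasGaussianLaw_wiener (hB : IsFBM H B P) (f : HSpacePow H d) : HasGaussianLaw (hB.wiener f) P :=
  ⟨by rw [hB.map_wiener]; infer_instance⟩

lemma memLp_wiener (hB : IsFBM H B P) (f : HSpacePow H d) {p : ℝ≥0∞} (hp : p ≠ ∞) :
    MemLp (hB.wiener f) p P := (hB.hasGaussianLaw_wiener f).memLp hp

lemma memLp_wiener_mul (hB : IsFBM H B P) (f g : HSpacePow H d) :
    MemLp (fun ω => hB.wiener f ω * hB.wiener g ω) 2 P := by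
  have : ENNReal.HolderTriple 4 4 2 := ⟨by
    rw [← two_mul, show (4 : ℝ≥0∞) = 2 * 2 by norm_num, ENNReal.mul_inv (by simp) (by simp),
      ← mul_assoc, ENNReal.mul_inv_cancel (by simp) (by simp), one_mul]⟩
  exact (hB.memLp_wiener g (p := 4) (by simp)).mul (hB.memLp_wiener f (p := 4) (by simp))

lemma memLp_wick (hB : IsFBM H B P) (f g : HSpacePow H d) :
    MemLp (fun ω => hB.wiener f ω * hB.wiener g ω - inner ℝ f g) 2 P := by
  have hP := hB.isProbabilityMeasure
  exact (hB.memLp_wiener_mul f g).sub (memLp_const _)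

/-- The linear map `f ⊗ g ↦ B(f) B(g) - ⟨f, g⟩` from the algebraic tensor square to `L²(Ω)`. In
particular `f ⊗ f ↦ H₂(B(f))` for every unit vector `f`, with the Hermite polynomial `H₂ = x² - 1`. -/
def wickTensor (hB : IsFBM H B P) : HSpacePow H d ⊗[ℝ] HSpacePow H d →ₗ[ℝ] Lp ℝ 2 P :=
  TensorProduct.lift <| LinearMap.mk₂ ℝ (fun f g => (hB.memLp_wick f g).toLp)
    (fun f f' g => by
      rw [← MemLp.toLp_add, MemLp.toLp_eq_toLp_iff, map_add]
      filter_upwards [Lp.coeFn_add (hB.wiener f) (hB.wiener f')] with ω h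
      simp only [h, Pi.add_apply, inner_add_left]
      ring)
    (fun r f g => by
      rw [← MemLp.toLp_const_smul, MemLp.toLp_eq_toLp_iff, map_smul]
      filter_upwards [Lp.coeFn_smul r (hB.wiener f)] with ω h
      simp only [h, Pi.smul_apply, inner_smul_left, smul_eq_mul, conj_trivial]
      ring)
    (fun f g g' => by
      rw [← MemLp.toLp_add, MemLp.toLp_eq_toLp_iff, map_add]
      filter_upwards [Lp.coeFn_add (hB.wiener g) (hB.wiener g')] with ω h
      simp only [h, Pi.add_apply, inner_add_right]
      ring)
    (fun r f g => by
      rw [← MemLp.toLp_const_smul, MemLp.toLp_eq_toLp_iff, map_smul]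
      filter_upwards [Lp.coeFn_smul r (hB.wiener g)] with ω h
      simp only [h, Pi.smul_apply, inner_smul_right, smul_eq_mul]
      ring)

lemma wickTensor_tmul (hB : IsFBM H B P) (f g : HSpacePow H d) :
    hB.wickTensor (f ⊗ₜ g) = (hB.memLp_wick f g).toLp := rfl

/-- The double Wiener integral `I₂ : (𝔥^d)^{⊗ 2} → L²(Ω)`, the continuous linear extension of
`f ⊗ g ↦ B(f) B(g) - ⟨f, g⟩` (see `I₂_coe` and `I₂_tmul_self`). As usual, `I₂` of a tensor is `I₂` of
its symmetrization. -/
def I₂ (hB : IsFBM H B P) : HSpaceTensor H d →L[ℝ] Lp ℝ 2 P :=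
  hB.wickTensor.extendOfNorm
    (UniformSpace.Completion.toComplL (𝕜 := ℝ) (E := HSpacePow H d ⊗[ℝ] HSpacePow H d)).toLinearMap

lemma integral_wiener_pow_four (hB : IsFBM H B P) (f : HSpacePow H d) :
    ∫ ω, hB.wiener f ω ^ 4 ∂P = 3 * (inner ℝ f f) ^ 2 := by
  have h := integral_pow_four_gaussianReal (‖f‖₊ ^ 2)
  rw [← hB.map_wiener, integral_map (hB.hasGaussianLaw_wiener f).aemeasurable
    (Continuous.aestronglyMeasurable (by fun_prop))] at h
  rw [h, real_inner_self_eq_norm_sq]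
  simp

lemma integral_wiener_mul₄ (hB : IsFBM H B P) (f g h k : HSpacePow H d) :
    ∫ ω, hB.wiener f ω * hB.wiener g ω * (hB.wiener h ω * hB.wiener k ω) ∂P
      = inner ℝ f g * inner ℝ h k + inner ℝ f h * inner ℝ g k + inner ℝ f k * inner ℝ g h := by
  have hP := hB.isProbabilityMeasure
  have hm : ∀ f, MemLp (hB.wiener f) 4 P := fun f => hB.memLp_wiener f (by simp)
  have hexp : ∀ β γ δ : ℝ, ∫ ω, (hB.wiener f ω + β * hB.wiener g ω + γ * hB.wiener h ω
      + δ * hB.wiener k ω) ^ 4 ∂P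
      = 3 * (inner ℝ (f + β • g + γ • h + δ • k) (f + β • g + γ • h + δ • k)) ^ 2 := by
    intro β γ δ
    rw [← hB.integral_wiener_pow_four]
    refine integral_congr_ae ?_
    simp only [map_add, map_smul]
    filter_upwards [Lp.coeFn_add (hB.wiener f + β • hB.wiener g + γ • hB.wiener h)
        (δ • hB.wiener k),
      Lp.coeFn_add (hB.wiener f + β • hB.wiener g) (γ • hB.wiener h),
      Lp.coeFn_add (hB.wiener f) (β • hB.wiener g),
      Lp.coeFn_smul β (hB.wiener g), Lp.coeFn_smul γ (hB.wiener h), Lp.coeFn_smul δ (hB.wiener k)]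
      with ω h1 h2 h3 h4 h5 h6
    rw [h1, Pi.add_apply, h2, Pi.add_apply, h3, Pi.add_apply, h4, h5, h6]
    simp
  have hint : ∀ β γ δ : ℝ, Integrable (fun ω => (hB.wiener f ω + β * hB.wiener g ω
      + γ * hB.wiener h ω + δ * hB.wiener k ω) ^ 4) P := by
    intro β γ δ
    have : MemLp (fun ω => hB.wiener f ω + β * hB.wiener g ω
      + γ * hB.wiener h ω + δ * hB.wiener k ω) 4 P :=
      (((hm f).add ((hm g).const_mul β)).add ((hm h).const_mul γ)).add ((hm k).const_mul δ)
    have h4 := this.integrable_norm_pow (by norm_num)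
    refine h4.congr (Eventually.of_forall fun ω => ?_)
    simp only [Real.norm_eq_abs]
    exact (by decide : Even 4).pow_abs _
  have hpol : ∀ ω, hB.wiener f ω * hB.wiener g ω * (hB.wiener h ω * hB.wiener k ω)
      = 1 / 192 * (
        (hB.wiener f ω + 1 * hB.wiener g ω + 1 * hB.wiener h ω + 1 * hB.wiener k ω) ^ 4
        - (hB.wiener f ω + 1 * hB.wiener g ω + 1 * hB.wiener h ω + (-1) * hB.wiener k ω) ^ 4
        - (hB.wiener f ω + 1 * hB.wiener g ω + (-1) * hB.wiener h ω + 1 * hB.wiener k ω) ^ 4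
        + (hB.wiener f ω + 1 * hB.wiener g ω + (-1) * hB.wiener h ω + (-1) * hB.wiener k ω) ^ 4
        - (hB.wiener f ω + (-1) * hB.wiener g ω + 1 * hB.wiener h ω + 1 * hB.wiener k ω) ^ 4
        + (hB.wiener f ω + (-1) * hB.wiener g ω + 1 * hB.wiener h ω + (-1) * hB.wiener k ω) ^ 4
        + (hB.wiener f ω + (-1) * hB.wiener g ω + (-1) * hB.wiener h ω + 1 * hB.wiener k ω) ^ 4
        - (hB.wiener f ω + (-1) * hB.wiener g ω + (-1) * hB.wiener h ω
          + (-1) * hB.wiener k ω) ^ 4) := by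
    intro ω; ring
  simp_rw [hpol]
  have a1 := (hint 1 1 1).sub (hint 1 1 (-1))
  have a2 := a1.sub (hint 1 (-1) 1)
  have a3 := a2.add (hint 1 (-1) (-1))
  have a4 := a3.sub (hint (-1) 1 1)
  have a5 := a4.add (hint (-1) 1 (-1))
  have a6 := a5.add (hint (-1) (-1) 1)
  rw [integral_const_mul, integral_sub, integral_add, integral_add, integral_sub, integral_add,
    integral_sub, integral_sub]
  · simp only [hexp, inner_add_left, inner_add_right, inner_smul_left, inner_smul_right,
      conj_trivial]
    rw [real_inner_comm f g, real_inner_comm f h, real_inner_comm f k, real_inner_comm g h,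
      real_inner_comm g k, real_inner_comm h k]
    ring
  all_goals first | exact hint _ _ _ | exact a1 | exact a2 | exact a3 | exact a4 | exact a5 | exact a6

lemma inner_wickTensor (hB : IsFBM H B P) (x y : HSpacePow H d ⊗[ℝ] HSpacePow H d) :
    inner ℝ (hB.wickTensor x) (hB.wickTensor y)
      = inner ℝ x y + inner ℝ (TensorProduct.comm ℝ _ _ x) y := by
  have hP := hB.isProbabilityMeasure
  induction x using TensorProduct.induction_on with
  | zero => simp
  | add x x' hx hx' => simp only [map_add, inner_add_left, hx, hx']; ring
  | tmul f g =>
    induction y using TensorProduct.induction_on with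
    | zero => simp
    | add y y' hy hy' => simp only [map_add, inner_add_right, hy, hy']; ring
    | tmul h k =>
      rw [wickTensor_tmul, wickTensor_tmul, L2.inner_def, TensorProduct.comm_tmul,
        TensorProduct.inner_tmul, TensorProduct.inner_tmul]
      have e : ∀ᵐ ω ∂P, inner ℝ ((hB.memLp_wick f g).toLp _ ω) ((hB.memLp_wick h k).toLp _ ω)
          = hB.wiener f ω * hB.wiener g ω * (hB.wiener h ω * hB.wiener k ω)
            - inner ℝ f g * (hB.wiener h ω * hB.wiener k ω)
            - inner ℝ h k * (hB.wiener f ω * hB.wiener g ω) + inner ℝ f g * inner ℝ h k := by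
        filter_upwards [(hB.memLp_wick f g).coeFn_toLp, (hB.memLp_wick h k).coeFn_toLp]
          with ω h1 h2
        rw [h1, h2]
        simp only [RCLike.inner_apply, conj_trivial]
        ring
      have hcov : ∀ f g : HSpacePow H d, ∫ ω, hB.wiener f ω * hB.wiener g ω ∂P = inner ℝ f g := by
        intro f g
        rw [← hB.inner_wiener, L2.inner_def]
        simp [mul_comm]
      have i2 : ∀ f g : HSpacePow H d, Integrable (fun ω => hB.wiener f ω * hB.wiener g ω) P :=
        fun f g => (hB.memLp_wiener_mul f g).integrable (by norm_num)
      have i4 : Integrable (fun ω => hB.wiener f ω * hB.wiener g ω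
          * (hB.wiener h ω * hB.wiener k ω)) P :=
        (hB.memLp_wiener_mul f g).integrable_mul (hB.memLp_wiener_mul h k)
      rw [integral_congr_ae e, integral_add, integral_sub, integral_sub, integral_const_mul,
        integral_const_mul, hcov, hcov, hB.integral_wiener_mul₄, integral_const]
      · simp only [probReal_univ, one_smul]
        ring
      · exact i4
      · exact (i2 h k).const_mul _
      · exact i4.sub ((i2 h k).const_mul _)
      · exact (i2 f g).const_mul _
      · exact (i4.sub ((i2 h k).const_mul _)).sub ((i2 f g).const_mul _)
      · exact integrable_const _

lemma norm_wickTensor_le (hB : IsFBM H B P) (x : HSpacePow H d ⊗[ℝ] HSpacePow H d) :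
    ‖hB.wickTensor x‖ ≤ √2 * ‖x‖ := by
  rw [← Real.sqrt_sq (norm_nonneg x), ← Real.sqrt_mul zero_le_two]
  refine Real.le_sqrt_of_sq_le ?_
  have h0 : inner ℝ x x = ‖x‖ ^ 2 := real_inner_self_eq_norm_sq x
  rw [← real_inner_self_eq_norm_sq, inner_wickTensor, h0]
  have h := real_inner_le_norm (TensorProduct.comm ℝ _ _ x) x
  have h2 : ‖TensorProduct.comm ℝ _ _ x‖ = ‖x‖ :=
    (TensorProduct.commIsometry ℝ (HSpacePow H d) (HSpacePow H d)).norm_map x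
  rw [h2] at h
  nlinarith

/-- `I₂` really extends `f ⊗ g ↦ B(f) B(g) - ⟨f, g⟩`. -/
lemma I₂_coe (hB : IsFBM H B P) (x : HSpacePow H d ⊗[ℝ] HSpacePow H d) :
    hB.I₂ (x : HSpaceTensor H d) = hB.wickTensor x := by
  have hd : DenseRange (UniformSpace.Completion.toComplL (𝕜 := ℝ)
      (E := HSpacePow H d ⊗[ℝ] HSpacePow H d)).toLinearMap := UniformSpace.Completion.denseRange_coe
  refine LinearMap.extendOfNorm_eq (f := hB.wickTensor) hd ⟨√2, fun x => ?_⟩ x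
  refine (hB.norm_wickTensor_le x).trans ?_
  exact mul_le_mul_of_nonneg_left (UniformSpace.Completion.norm_coe x).ge (by positivity)

/-- `I₂ (f ⊗ f) = H₂(B(f))` for unit vectors `f`. -/
lemma I₂_tmul_self (hB : IsFBM H B P) (f : HSpacePow H d) (hf : ‖f‖ = 1) :
    hB.I₂ ((f ⊗ₜ[ℝ] f : HSpacePow H d ⊗[ℝ] HSpacePow H d) : HSpaceTensor H d)
      =ᵐ[P] fun ω => (Polynomial.hermite 2).aeval (hB.wiener f ω) := by
  rw [I₂_coe, wickTensor_tmul]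
  filter_upwards [(hB.memLp_wick f f).coeFn_toLp] with ω h
  rw [h, real_inner_self_eq_norm_sq, hf]
  simp [Polynomial.hermite_succ]

end IsFBM

/-- The element `1_{[s, t]}` of `𝔥`, for `s ≤ t`. -/
def indIcc (H : HurstIndex) (s t : ℝ≥0) : HSpace H :=
  ((StepFun.ind t - StepFun.ind s : StepFun H) : HSpace H)

/-- `α(i, j) = E[X_i X_j]` for independent standard Gaussian variables `X_1, …, X_d`. -/
def alpha {d : ℕ} (i j : Fin d) : ℝ :=
  ∫ x : Fin d → ℝ, x i * x j ∂(Measure.pi fun _ => gaussianReal 0 1)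

/-- The kernel `f_{2,s,t}^ε`, which at the indices `i, j` and at `(x, y)` takes the value
`-((2π)^{-d/2} α(i, j) / 2!) (ε + (t - s)^{2H})^{-d/2-1} 1_{[s, t]}(x) 1_{[s, t]}(y)`,
as an element of `(𝔥^d)^{⊗ 2}`. -/
def kernelF (H : HurstIndex) (d : ℕ) (ε : ℝ) (s t : ℝ≥0) : HSpaceTensor H d :=
  ∑ i : Fin d, ∑ j : Fin d,
    (-((2 * Real.pi) ^ (-(d : ℝ) / 2) * alpha i j / (Nat.factorial 2 : ℝ))
        * (ε + ((t : ℝ) - s) ^ (2 * (H : ℝ))) ^ (-(d : ℝ) / 2 - 1)) •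
      ((PiLp.single 2 i (indIcc H s t) ⊗ₜ[ℝ] PiLp.single 2 j (indIcc H s t) :
        HSpacePow H d ⊗[ℝ] HSpacePow H d) : HSpaceTensor H d)

/-- The kernel `h_{2,T}^ε = ∫_{0 ≤ s ≤ t ≤ T} f_{2,s,t}^ε ds dt` of the second chaos component of
the approximate self-intersection local time on `[0, T]`. -/
def kernelH (H : HurstIndex) (d : ℕ) (ε : ℝ) (T : ℝ≥0) : HSpaceTensor H d :=
  ∫ p in {p : ℝ × ℝ | 0 ≤ p.1 ∧ p.1 ≤ p.2 ∧ p.2 ≤ T}, kernelF H d ε p.1.toNNReal p.2.toNNReal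

/-- The function whose integral over `(0, ∞)` enters the limiting constant. -/
def rhoIntegrand (d : ℕ) (u : ℝ) : ℝ := (1 + u ^ (3 / 2 : ℝ)) ^ (-(d : ℝ) / 2 - 1) * u ^ 2

/-- The limiting constant `ρ`. -/
def rho (d : ℕ) : ℝ :=
  √(3 * d) / (2 ^ (((d : ℝ) + 5) / 2) * Real.pi ^ ((d : ℝ) / 2))
    * ∫ u in Set.Ioi (0 : ℝ), rhoIntegrand d u

end
end SelfIntersection

/-!
Why the theorem is true. By the isometry property of `I₂` the covariance of the two double integrals
is a constant times the integral, over pairs of time intervals `[s, s + u] ⊆ [0, T₁]` and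
`[s', s' + u'] ⊆ [0, T₂]`, of `w u * w u' * μ ^ 2`. Here `w u = (ε + u ^ (3 / 2)) ^ (-d / 2 - 1)`, and
`μ` (`incrCov`) is the covariance of the increments of a one-dimensional fractional Brownian motion
over the two intervals (`IsFBM.integral_I₂_kernelH_mul`).

Let `δ = ε ^ (2 / 3)` and `N = 1 / δ`. The substitution `u = δ a`, `u' = δ b`, `s' = s + δ y` is
compatible with the self-similarity of both `w` and `μ` and produces exactly the factor
`ε ^ (2 - d)` (`integral_covIntegrand`). What is left is an integral over `s`, `a` and `b` of
`(1 + a ^ (3 / 2)) ^ (-d / 2 - 1) * (1 + b ^ (3 / 2)) ^ (-d / 2 - 1)` times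
`∫ incrCov y a b ^ 2 dy`, where `y` runs through `[-s N, (T₂ - s) N - b]`.

For `H = 3 / 4` the exponent of the squared long-range correlation is critical: as `|y| → ∞`,
`incrCov y a b ^ 2` is asymptotic to `(3 / 8) ^ 2 * (a b) ^ 2 / |y|` (`tendsto_mul_sq_incrCov`), so
the `y`-integral grows like `log N`. If `s < T₂` both ends of the interval of integration contribute
and the limit after division by `log N` is `2 * (3 / 8) ^ 2 * (a b) ^ 2`
(`tendsto_sqCovIntegral_of_lt`); if `s > T₂` the interval lies far from the origin and the limit is
`0` (`tendsto_sqCovIntegral_of_gt`). Together with `s < T₁` this leaves `s ∈ [0, min T₁ T₂]`.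

The limit may be taken under the integral over `s`, `a`, `b`, because
`incrCov y a b ≤ (3 / 2) * a * b / √|y|` holds for all `y`, not only for large ones
(`abs_mul_sq_incrCov_le`), and `incrCov y a b ≤ (3 / 2) * b * √a` takes care of small `y`. Both follow
from a single application of the mean value theorem to the second difference `incrCov`
(`exists_incrCov_eq`). The limiting integral in `a` and `b` is the square of the integral in `ρ`, and
`log (1 / ε) = (3 / 2) * log N` gives the constant (`sq_rho_eq`).
-/

/-! ### The covariance of two increments -/

namespace SelfIntersection

/-- The covariance of the increments of a fractional Brownian motion with `2H = 3/2` over two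
intervals of lengths `a` and `b`, the second starting at distance `y` (of any sign) after the
first. -/
noncomputable def incrCov (y a b : ℝ) : ℝ :=
  (|y + b| ^ (3 / 2 : ℝ) + |y - a| ^ (3 / 2 : ℝ) - |y| ^ (3 / 2 : ℝ)
    - |y + b - a| ^ (3 / 2 : ℝ)) / 2

/-- The odd square root `sign z * √|z|`, written with the convention `√x = 0` for `x ≤ 0`. -/
noncomputable def oddSqrt (z : ℝ) : ℝ := √z - √(-z)

lemma continuous_incrCov : Continuous fun p : ℝ × ℝ × ℝ => incrCov p.1 p.2.1 p.2.2 := by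
  have h : Continuous fun x : ℝ => |x| ^ (3 / 2 : ℝ) :=
    continuous_abs.rpow_const fun _ => Or.inr (by norm_num)
  unfold incrCov
  have h1 := h.comp (show Continuous fun p : ℝ × ℝ × ℝ => p.1 + p.2.2 by fun_prop)
  have h2 := h.comp (show Continuous fun p : ℝ × ℝ × ℝ => p.1 - p.2.1 by fun_prop)
  have h3 := h.comp (show Continuous fun p : ℝ × ℝ × ℝ => p.1 by fun_prop)
  have h4 := h.comp (show Continuous fun p : ℝ × ℝ × ℝ => p.1 + p.2.2 - p.2.1 by fun_prop)
  exact (((h1.add h2).sub h3).sub h4).div_const 2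

lemma incrCov_neg (y a b : ℝ) : incrCov (-y) a b = incrCov y b a := by
  unfold incrCov
  rw [← abs_neg (-y + b), ← abs_neg (-y - a), ← abs_neg (-y + b - a), abs_neg y]
  ring_nf

lemma incrCov_mul {δ : ℝ} (hδ : 0 ≤ δ) (y a b : ℝ) :
    incrCov (δ * y) (δ * a) (δ * b) = δ ^ (3 / 2 : ℝ) * incrCov y a b := by
  have h : ∀ x : ℝ, |δ * x| ^ (3 / 2 : ℝ) = δ ^ (3 / 2 : ℝ) * |x| ^ (3 / 2 : ℝ) := fun x => by
    rw [abs_mul, abs_of_nonneg hδ, Real.mul_rpow hδ (abs_nonneg x)]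
  unfold incrCov
  rw [← mul_add, ← mul_sub, ← mul_sub, h, h, h, h]
  ring

lemma monotone_oddSqrt : Monotone oddSqrt := fun _ _ h =>
  sub_le_sub (Real.sqrt_le_sqrt h) (Real.sqrt_le_sqrt (neg_le_neg h))

lemma hasDerivAt_abs_rpow_three_halves (x : ℝ) :
    HasDerivAt (fun x : ℝ => |x| ^ (3 / 2 : ℝ)) (3 / 2 * oddSqrt x) x := by
  convert hasDerivAt_abs_rpow x (p := 3 / 2) (by norm_num) using 1
  rw [mul_assoc]
  congr 1
  have key : ∀ z : ℝ, 0 < z → √z = z ^ (3 / 2 - 2 : ℝ) * z := fun z hz => by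
    rw [Real.sqrt_eq_rpow]
    nth_rewrite 3 [← Real.rpow_one z]
    rw [← Real.rpow_add hz]
    norm_num
  unfold oddSqrt
  rcases lt_trichotomy x 0 with h | rfl | h
  · rw [Real.sqrt_eq_zero_of_nonpos h.le, abs_of_neg h, key (-x) (by linarith)]
    ring
  · simp
  · rw [Real.sqrt_eq_zero_of_nonpos (by linarith : -x ≤ 0), abs_of_pos h, key x h]
    ring

/-- The increments of `oddSqrt` ending at `η > 0` are at most linear in their length. -/
lemma oddSqrt_sub_le {η a : ℝ} (hη : 0 < η) (ha : 0 ≤ a) :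
    oddSqrt η - oddSqrt (η - a) ≤ 2 * a / √η := by
  have h0 := Real.sqrt_pos.2 hη
  unfold oddSqrt
  rw [Real.sqrt_eq_zero_of_nonpos (by linarith : -η ≤ 0), le_div_iff₀ h0]
  have e0 := Real.mul_self_sqrt hη.le
  rcases le_total a η with h | h
  · rw [Real.sqrt_eq_zero_of_nonpos (by linarith : -(η - a) ≤ 0)]
    have e1 := Real.mul_self_sqrt (by linarith : 0 ≤ η - a)
    have h1 : √(η - a) ≤ √η := Real.sqrt_le_sqrt (by linarith)
    have h2 := Real.sqrt_nonneg (η - a)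
    nlinarith
  · rw [Real.sqrt_eq_zero_of_nonpos (by linarith : η - a ≤ 0)]
    have e1 := Real.mul_self_sqrt (by linarith : 0 ≤ -(η - a))
    have h2 := Real.sqrt_nonneg (-(η - a))
    nlinarith [sq_nonneg (√η - √(-(η - a)))]

lemma oddSqrt_sub_le_sqrt (η : ℝ) {a : ℝ} (ha : 0 ≤ a) :
    oddSqrt η - oddSqrt (η - a) ≤ 2 * √a := by
  have key : ∀ z : ℝ, √(z + a) ≤ √z + √a := fun z => by
    rcases le_total 0 z with hz | hz
    · refine Real.sqrt_le_iff.2 ⟨by positivity, ?_⟩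
      nlinarith [Real.sq_sqrt hz, Real.sq_sqrt ha, Real.sqrt_nonneg z, Real.sqrt_nonneg a]
    · rw [Real.sqrt_eq_zero_of_nonpos hz, zero_add]
      exact Real.sqrt_le_sqrt (by linarith)
  have h1 := key (η - a)
  have h2 := key (-η)
  unfold oddSqrt
  rw [sub_add_cancel] at h1
  rw [show -(η - a) = -η + a by ring]
  linarith

/-- Mean value theorem for the second difference `incrCov`. -/
lemma exists_incrCov_eq (y a : ℝ) {b : ℝ} (hb : 0 ≤ b) :
    ∃ η ∈ Set.Icc y (y + b), incrCov y a b = 3 / 4 * b * (oddSqrt η - oddSqrt (η - a)) := by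
  rcases hb.eq_or_lt with rfl | hb
  · exact ⟨y, by simp, by simp [incrCov]⟩
  have hd : ∀ z : ℝ, HasDerivAt (fun z : ℝ => |z| ^ (3 / 2 : ℝ) - |z - a| ^ (3 / 2 : ℝ))
      (3 / 2 * oddSqrt z - 3 / 2 * oddSqrt (z - a)) z := fun z =>
    (hasDerivAt_abs_rpow_three_halves z).sub
      ((hasDerivAt_abs_rpow_three_halves (z - a)).comp_sub_const z a)
  obtain ⟨η, hη, h⟩ := exists_hasDerivAt_eq_slope _ _ (by linarith : y < y + b)
    (fun z _ => (hd z).continuousAt.continuousWithinAt) fun z _ => hd z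
  refine ⟨η, Set.Ioo_subset_Icc_self hη, ?_⟩
  rw [eq_div_iff (by linarith)] at h
  unfold incrCov
  linear_combination -h / 2

lemma incrCov_nonneg (y : ℝ) {a b : ℝ} (ha : 0 ≤ a) (hb : 0 ≤ b) : 0 ≤ incrCov y a b := by
  obtain ⟨η, -, h⟩ := exists_incrCov_eq y a hb
  rw [h]
  have := monotone_oddSqrt (by linarith : η - a ≤ η)
  exact mul_nonneg (by positivity) (by linarith)

lemma incrCov_le (y : ℝ) {a b : ℝ} (ha : 0 ≤ a) (hb : 0 ≤ b) :
    incrCov y a b ≤ 3 / 2 * b * √a := by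
  obtain ⟨η, -, h⟩ := exists_incrCov_eq y a hb
  rw [h]
  have := mul_le_mul_of_nonneg_left (oddSqrt_sub_le_sqrt η ha) (by positivity : 0 ≤ 3 / 4 * b)
  linarith

lemma incrCov_le_div_of_pos {y a b : ℝ} (hy : 0 < y) (ha : 0 ≤ a) (hb : 0 ≤ b) :
    incrCov y a b ≤ 3 / 2 * (a * b) / √y := by
  obtain ⟨η, hη, h⟩ := exists_incrCov_eq y a hb
  have hη0 : 0 < η := hy.trans_le hη.1
  rw [h]
  have h1 := mul_le_mul_of_nonneg_left (oddSqrt_sub_le hη0 ha) (by positivity : 0 ≤ 3 / 4 * b)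
  have h2 : 2 * a / √η ≤ 2 * a / √y :=
    div_le_div_of_nonneg_left (by positivity) (Real.sqrt_pos.2 hy) (Real.sqrt_le_sqrt hη.1)
  have h3 := mul_le_mul_of_nonneg_left h2 (by positivity : 0 ≤ 3 / 4 * b)
  refine (h1.trans h3).trans_eq ?_
  ring

lemma sq_incrCov_le (y : ℝ) {a b : ℝ} (ha : 0 ≤ a) (hb : 0 ≤ b) :
    incrCov y a b ^ 2 ≤ 9 / 4 * (a * b ^ 2) := by
  have h := pow_le_pow_left₀ (incrCov_nonneg y ha hb) (incrCov_le y ha hb) 2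
  rw [mul_pow, Real.sq_sqrt ha] at h
  linarith

lemma abs_mul_sq_incrCov_le (y : ℝ) {a b : ℝ} (ha : 0 ≤ a) (hb : 0 ≤ b) :
    |y| * incrCov y a b ^ 2 ≤ 9 / 4 * (a * b) ^ 2 := by
  have key : ∀ y a b : ℝ, 0 < y → 0 ≤ a → 0 ≤ b →
      |y| * incrCov y a b ^ 2 ≤ 9 / 4 * (a * b) ^ 2 := by
    intro y a b hy ha hb
    have h := pow_le_pow_left₀ (incrCov_nonneg y ha hb) (incrCov_le_div_of_pos hy ha hb) 2
    rw [div_pow, Real.sq_sqrt hy.le, le_div_iff₀ hy] at h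
    rw [abs_of_pos hy]
    linarith
  rcases lt_trichotomy y 0 with h | rfl | h
  · have := key (-y) b a (by linarith) hb ha
    rwa [incrCov_neg, abs_neg, mul_comm b a] at this
  · simp only [abs_zero, zero_mul]
    positivity
  · exact key y a b h ha hb

/-- Two increments at a large distance `y` have covariance `H (2H - 1) a b y ^ (2H - 2)` to leading
order; squared, this is `(3 / 8) ^ 2 * (a * b) ^ 2 / y`. -/
lemma tendsto_mul_sq_incrCov {a b : ℝ} (ha : 0 ≤ a) (hb : 0 ≤ b) :
    Tendsto (fun y => y * incrCov y a b ^ 2) atTop (𝓝 (9 / 64 * (a * b) ^ 2)) := by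
  have hlim : ∀ c : ℝ, Tendsto (fun y : ℝ => √((y + c) / y)) atTop (𝓝 1) := fun c => by
    rw [← Real.sqrt_one]
    refine (Real.continuous_sqrt.tendsto 1).comp ?_
    have h : Tendsto (fun y : ℝ => 1 + c / y) atTop (𝓝 (1 + 0)) :=
      tendsto_const_nhds.add (tendsto_const_nhds.div_atTop tendsto_id)
    rw [add_zero] at h
    refine h.congr' ?_
    filter_upwards [eventually_gt_atTop 0] with y hy
    field_simp
  have hs : Tendsto (fun y => √y * incrCov y a b) atTop (𝓝 (3 / 8 * (a * b))) := by
    have h1 : Tendsto (fun y => 3 / 8 * (a * b) / √((y + b) / y)) atTop (𝓝 (3 / 8 * (a * b))) := by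
      have := (tendsto_const_nhds (x := 3 / 8 * (a * b))).div (hlim b) one_ne_zero
      rwa [div_one] at this
    have h2 : Tendsto (fun y => 3 / 8 * (a * b) / √((y + -a) / y)) atTop
        (𝓝 (3 / 8 * (a * b))) := by
      have := (tendsto_const_nhds (x := 3 / 8 * (a * b))).div (hlim (-a)) one_ne_zero
      rwa [div_one] at this
    have key : ∀ y, 0 < y → a < y → ∃ r, √(y + -a) ≤ r ∧ r ≤ √(y + b) ∧
        √y * incrCov y a b = 3 / 8 * (a * b) / (r / √y) := by
      intro y hy hay
      obtain ⟨η, hη, h⟩ := exists_incrCov_eq y a hb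
      have p1 : √(y + -a) ≤ √(η - a) := Real.sqrt_le_sqrt (by linarith [hη.1])
      have p2 : √(η - a) ≤ √η := Real.sqrt_le_sqrt (by linarith)
      have p3 : √η ≤ √(y + b) := Real.sqrt_le_sqrt hη.2
      have p0 : 0 < √(y + -a) := Real.sqrt_pos.2 (by linarith)
      refine ⟨(√η + √(η - a)) / 2, by linarith, by linarith, ?_⟩
      have e1 := Real.mul_self_sqrt (by linarith [hη.1] : 0 ≤ η)
      have e2 := Real.mul_self_sqrt (by linarith [hη.1] : 0 ≤ η - a)
      have hsum : 0 < √η + √(η - a) := by linarith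
      have hy' := Real.sqrt_pos.2 hy
      rw [h, oddSqrt, oddSqrt, Real.sqrt_eq_zero_of_nonpos (by linarith [hη.1] : -η ≤ 0),
        Real.sqrt_eq_zero_of_nonpos (by linarith [hη.1] : -(η - a) ≤ 0)]
      field_simp
      linear_combination 8 * b * (e1 - e2)
    refine tendsto_of_tendsto_of_tendsto_of_le_of_le' h1 h2 ?_ ?_
    all_goals
      filter_upwards [eventually_gt_atTop 0, eventually_gt_atTop a] with y hy hay
      obtain ⟨r, hr1, hr2, hr⟩ := key y hy hay
      have p0 : 0 < √(y + -a) := Real.sqrt_pos.2 (by linarith)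
      have hy' := Real.sqrt_pos.2 hy
      have hab : 0 ≤ 3 / 8 * (a * b) := by positivity
      rw [hr, Real.sqrt_div' _ hy.le]
      have hr0 : 0 < r := p0.trans_le hr1
      gcongr
  have := hs.pow 2
  rw [mul_pow] at this
  norm_num at this
  refine (this.congr' ?_).trans (by rw [mul_pow])
  filter_upwards [eventually_ge_atTop 0] with y hy
  rw [mul_pow, Real.sq_sqrt hy]

end SelfIntersection

/-! ### Logarithmic growth of the integrated squared covariance -/

namespace SelfIntersection

/-- If `m y` behaves like `κ / y` at infinity, its integral grows like `κ * log N`. -/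
lemma tendsto_integral_div_log {m : ℝ → ℝ} (hm : Continuous m) {K κ : ℝ}
    (hK : ∀ y, 0 ≤ y → |y * m y| ≤ K) (hκ : Tendsto (fun y => y * m y) atTop (𝓝 κ)) :
    Tendsto (fun N => (∫ y in (0 : ℝ)..N, m y) / Real.log N) atTop (𝓝 κ) := by
  have hlog := Real.tendsto_log_atTop
  -- the substitution `y = N ^ r` turns `∫ y in 1..N, m y` into an average over `r ∈ [0, 1]`
  have hsub : ∀ N : ℝ, 1 < N → (∫ y in (0 : ℝ)..N, m y) / Real.log N
      = (∫ y in (0 : ℝ)..1, m y) / Real.log N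
        + ∫ r in (0 : ℝ)..1, Real.exp (Real.log N * r) * m (Real.exp (Real.log N * r)) := by
    intro N hN
    have hl : 0 < Real.log N := Real.log_pos hN
    have h := intervalIntegral.integral_comp_mul_deriv (a := (0 : ℝ)) (b := 1)
      (f := fun r => Real.exp (Real.log N * r))
      (f' := fun r => Real.exp (Real.log N * r) * Real.log N) (g := m)
      (fun x _ => by
        simpa using ((hasDerivAt_id x).const_mul (Real.log N)).exp)
      (by fun_prop) hm
    simp only [mul_zero, Real.exp_zero, mul_one, Real.exp_log (by linarith : 0 < N)] at h
    rw [← intervalIntegral.integral_add_adjacent_intervals (hm.intervalIntegrable 0 1)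
      (hm.intervalIntegrable 1 N), ← h, add_div]
    congr 1
    rw [← intervalIntegral.integral_div]
    refine intervalIntegral.integral_congr fun r _ => ?_
    simp only [Function.comp]
    field_simp
  have h1 : Tendsto (fun N => (∫ y in (0 : ℝ)..1, m y) / Real.log N) atTop (𝓝 0) :=
    tendsto_const_nhds.div_atTop hlog
  have h2 : Tendsto (fun N => ∫ r in (0 : ℝ)..1,
      Real.exp (Real.log N * r) * m (Real.exp (Real.log N * r))) atTop
      (𝓝 (∫ _ in (0 : ℝ)..1, κ)) := by
    refine intervalIntegral.tendsto_integral_filter_of_dominated_convergence (fun _ => K) ?_ ?_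
      (by simp) ?_
    · exact Eventually.of_forall fun N => Continuous.aestronglyMeasurable (by fun_prop)
    · exact Eventually.of_forall fun N => Eventually.of_forall fun r _ => hK _ (Real.exp_pos _).le
    · refine Eventually.of_forall fun r hr => ?_
      rw [Set.uIoc_of_le zero_le_one] at hr
      exact hκ.comp (Real.tendsto_exp_atTop.comp (hlog.atTop_mul_const hr.1))
  have h3 := h1.add h2
  rw [zero_add, intervalIntegral.integral_const, sub_zero, one_smul] at h3
  refine h3.congr' ?_
  filter_upwards [eventually_gt_atTop 1] with N hN
  exact (hsub N hN).symm

lemma tendsto_integral_div_log_of_tendsto_div {m : ℝ → ℝ} (hm : Continuous m) {K κ : ℝ}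
    (hK : ∀ y, 0 ≤ y → |y * m y| ≤ K) (hκ : Tendsto (fun y => y * m y) atTop (𝓝 κ))
    {M : ℝ → ℝ} {c : ℝ} (hc : 0 < c) (hM : Tendsto (fun N => M N / N) atTop (𝓝 c)) :
    Tendsto (fun N => (∫ y in (0 : ℝ)..M N, m y) / Real.log N) atTop (𝓝 κ) := by
  have hMtop : Tendsto M atTop atTop := by
    refine (hM.pos_mul_atTop hc tendsto_id).congr' ?_
    filter_upwards [eventually_gt_atTop 0] with N hN
    exact div_mul_cancel₀ _ hN.ne'
  have hl : Tendsto (fun N => Real.log (M N) / Real.log N) atTop (𝓝 1) := by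
    have h1 : Tendsto (fun N => Real.log (M N / N) / Real.log N) atTop (𝓝 0) :=
      (hM.log hc.ne').div_atTop Real.tendsto_log_atTop
    have h2 := h1.add_const 1
    rw [zero_add] at h2
    refine h2.congr' ?_
    filter_upwards [eventually_gt_atTop 1, hMtop.eventually_gt_atTop 0] with N hN hMN
    have := Real.log_pos hN
    rw [Real.log_div hMN.ne' (by linarith)]
    field_simp
    ring
  have h := ((tendsto_integral_div_log hm hK hκ).comp hMtop).mul hl
  rw [mul_one] at h
  refine h.congr' ?_
  filter_upwards [hMtop.eventually_gt_atTop 1] with N hN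
  have := Real.log_pos hN
  simp only [Function.comp]
  field_simp

/-- The bound by `A` is used on `[0, 1]`, the bound by `K / y` on `[1, R]`. -/
lemma integral_le_add_log {m : ℝ → ℝ} (hm : Continuous m) {A K R : ℝ} (hA : ∀ y, m y ≤ A)
    (hK : ∀ y, 0 ≤ y → y * m y ≤ K) (hR : 1 ≤ R) :
    ∫ y in (0 : ℝ)..R, m y ≤ A + K * Real.log R := by
  rw [← intervalIntegral.integral_add_adjacent_intervals (hm.intervalIntegrable 0 1)
    (hm.intervalIntegrable 1 R)]
  refine add_le_add ?_ ?_
  · refine (intervalIntegral.integral_mono_on zero_le_one (hm.intervalIntegrable 0 1)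
      (g := fun _ => A) (by simp) fun y _ => hA y).trans ?_
    simp
  · have hc : ContinuousOn (fun y : ℝ => K * y⁻¹) (Set.uIcc 1 R) := by
      rw [Set.uIcc_of_le hR]
      exact continuousOn_const.mul (continuousOn_inv₀.mono fun y hy =>
        (zero_lt_one.trans_le hy.1).ne')
    refine (intervalIntegral.integral_mono_on hR (hm.intervalIntegrable 1 R)
      (g := fun y => K * y⁻¹) hc.intervalIntegrable fun y hy => ?_).trans ?_
    · have hy0 : 0 < y := zero_lt_one.trans_le hy.1
      rw [← div_eq_mul_inv, le_div_iff₀ hy0, mul_comm]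
      exact hK y hy0.le
    · rw [intervalIntegral.integral_const_mul, integral_inv_of_pos one_pos (by linarith), div_one]

lemma continuous_sq_incrCov (a b : ℝ) : Continuous fun y => incrCov y a b ^ 2 :=
  (continuous_incrCov.comp (show Continuous fun y : ℝ => (y, a, b) by fun_prop)).pow 2

lemma integral_sq_incrCov_neg (a b R : ℝ) :
    ∫ y in -R..0, incrCov y a b ^ 2 = ∫ y in (0 : ℝ)..R, incrCov y b a ^ 2 := by
  simp_rw [← incrCov_neg _ a b]
  rw [intervalIntegral.integral_comp_neg fun y => incrCov y a b ^ 2, neg_zero]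

/-- The integral of the squared covariance over the distances `y` allowed for two increments of
rescaled lengths `a` and `b`, the first starting at time `s`, the second one contained in
`[0, T]`, when time is measured in units of `1 / N`. -/
noncomputable def sqCovIntegral (s T a b N : ℝ) : ℝ :=
  ∫ y in Set.Icc (-(s * N)) ((T - s) * N - b), incrCov y a b ^ 2

lemma sqCovIntegral_nonneg (s T a b N : ℝ) : 0 ≤ sqCovIntegral s T a b N :=
  integral_nonneg fun _ => sq_nonneg _

variable {s T a b : ℝ}

lemma tendsto_sqCovIntegral_of_lt (hs : 0 < s) (hsT : s < T) (ha : 0 ≤ a) (hb : 0 ≤ b) :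
    Tendsto (fun N => sqCovIntegral s T a b N / Real.log N) atTop
      (𝓝 (9 / 32 * (a * b) ^ 2)) := by
  have hbd : ∀ a b : ℝ, 0 ≤ a → 0 ≤ b → ∀ y, 0 ≤ y →
      |y * incrCov y a b ^ 2| ≤ 9 / 4 * (a * b) ^ 2 := fun a b ha hb y hy => by
    have h := abs_mul_sq_incrCov_le y ha hb
    rwa [abs_mul, abs_of_nonneg (sq_nonneg (incrCov y a b))]
  have hM1 : Tendsto (fun N : ℝ => (s * N) / N) atTop (𝓝 s) := by
    refine tendsto_const_nhds.congr' ?_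
    filter_upwards [eventually_gt_atTop 0] with N hN
    field_simp
  have hM2 : Tendsto (fun N : ℝ => ((T - s) * N - b) / N) atTop (𝓝 (T - s)) := by
    have h : Tendsto (fun N : ℝ => (T - s) - b / N) atTop (𝓝 (T - s - 0)) :=
      tendsto_const_nhds.sub (tendsto_const_nhds.div_atTop tendsto_id)
    rw [sub_zero] at h
    refine h.congr' ?_
    filter_upwards [eventually_gt_atTop 0] with N hN
    field_simp
  have h1 := tendsto_integral_div_log_of_tendsto_div (continuous_sq_incrCov b a)
    (hbd b a hb ha) (tendsto_mul_sq_incrCov hb ha) hs hM1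
  have h2 := tendsto_integral_div_log_of_tendsto_div (continuous_sq_incrCov a b)
    (hbd a b ha hb) (tendsto_mul_sq_incrCov ha hb) (sub_pos.2 hsT) hM2
  have h3 := h1.add h2
  rw [show 9 / 64 * (b * a) ^ 2 + 9 / 64 * (a * b) ^ 2 = 9 / 32 * (a * b) ^ 2 by ring] at h3
  refine h3.congr' ?_
  have hlarge : ∀ᶠ N : ℝ in atTop, b / (T - s) ≤ N := eventually_ge_atTop _
  filter_upwards [hlarge, eventually_gt_atTop 0] with N hN hN0
  have hN' : 0 ≤ (T - s) * N - b := by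
    rw [div_le_iff₀ (sub_pos.2 hsT)] at hN
    linarith
  have hsN : 0 < s * N := mul_pos hs hN0
  rw [sqCovIntegral, integral_Icc_eq_integral_Ioc, ← intervalIntegral.integral_of_le (by linarith),
    ← intervalIntegral.integral_add_adjacent_intervals (a := -(s * N)) (b := 0)
      ((continuous_sq_incrCov a b).intervalIntegrable _ _)
      ((continuous_sq_incrCov a b).intervalIntegrable _ _), integral_sq_incrCov_neg, add_div]

lemma tendsto_sqCovIntegral_of_gt (hT : 0 ≤ T) (hsT : T < s) (ha : 0 ≤ a) (hb : 0 ≤ b) :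
    Tendsto (fun N => sqCovIntegral s T a b N / Real.log N) atTop (𝓝 0) := by
  -- the interval of integration stays at a distance of order `N` from `0`, so that the integral
  -- stays bounded
  have h1 : Tendsto (fun N : ℝ => T * (9 / 4 * (a * b) ^ 2 / (s - T)) / Real.log N) atTop (𝓝 0) :=
    tendsto_const_nhds.div_atTop Real.tendsto_log_atTop
  refine squeeze_zero' ?_ ?_ h1
  · filter_upwards [eventually_gt_atTop 1] with N hN
    exact div_nonneg (sqCovIntegral_nonneg _ _ _ _ _) (Real.log_pos hN).le
  filter_upwards [eventually_gt_atTop 1] with N hN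
  refine div_le_div_of_nonneg_right ?_ (Real.log_pos hN).le
  have hN0 : 0 < N := by linarith
  have hd : 0 < (s - T) * N := mul_pos (by linarith) hN0
  have hfin : volume (Set.Icc (-(s * N)) (-((s - T) * N))) < ∞ := by simp
  have hsub : Set.Icc (-(s * N)) ((T - s) * N - b) ⊆ Set.Icc (-(s * N)) (-((s - T) * N)) :=
    Set.Icc_subset_Icc_right (by linarith)
  calc sqCovIntegral s T a b N
      ≤ ∫ y in Set.Icc (-(s * N)) (-((s - T) * N)), incrCov y a b ^ 2 :=
        setIntegral_mono_set ((continuous_sq_incrCov a b).integrableOn_Icc)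
          (Eventually.of_forall fun _ => sq_nonneg _) hsub.eventuallyLE
    _ ≤ ∫ _ in Set.Icc (-(s * N)) (-((s - T) * N)), 9 / 4 * (a * b) ^ 2 / ((s - T) * N) := by
        refine setIntegral_mono_on (continuous_sq_incrCov a b).integrableOn_Icc
          (integrableOn_const hfin.ne) measurableSet_Icc fun y hy => ?_
        rw [le_div_iff₀ hd]
        have h := abs_mul_sq_incrCov_le y ha hb
        have hy2 : (s - T) * N ≤ |y| := by
          rw [abs_of_nonpos (by linarith [hy.2])]
          linarith [hy.2]
        have := mul_le_mul_of_nonneg_right hy2 (sq_nonneg (incrCov y a b))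
        linarith
    _ = T * (9 / 4 * (a * b) ^ 2 / (s - T)) := by
        have : 0 ≤ T * N := by positivity
        rw [setIntegral_const, Real.volume_real_Icc_of_le (by linarith), smul_eq_mul]
        have : 0 < s - T := by linarith
        field_simp
        ring

/-- The bound that dominates the integrands in the passage to the limit: uniform in `N`, and of
growth in `a` and `b` that the weights of the kernels can absorb. -/
lemma sqCovIntegral_div_log_le {R N : ℝ} (hR : 1 ≤ R) (hsR : s ≤ R) (hs : 0 ≤ s) (hT : T ≤ R)
    (ha : 0 ≤ a) (hb : 0 ≤ b) (hN : Real.exp 1 ≤ N) :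
    sqCovIntegral s T a b N / Real.log N
      ≤ 9 / 2 * (2 + Real.log R) * ((1 + a ^ 2) * (1 + b ^ 2)) := by
  have hl : 1 ≤ Real.log N := by
    rw [← Real.log_exp 1]
    exact Real.log_le_log (Real.exp_pos 1) hN
  have hN1 : 1 ≤ N := le_trans (by linarith [Real.add_one_le_exp (1 : ℝ)]) hN
  have hRN : 1 ≤ R * N := one_le_mul_of_one_le_of_one_le hR hN1
  have hlR : 0 ≤ Real.log R := Real.log_nonneg hR
  have hb1 : ∀ a b : ℝ, 0 ≤ a → 0 ≤ b → ∫ y in (0 : ℝ)..R * N, incrCov y a b ^ 2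
      ≤ 9 / 4 * (a * b ^ 2) + 9 / 4 * (a * b) ^ 2 * Real.log (R * N) := fun a b ha hb =>
    integral_le_add_log (continuous_sq_incrCov a b) (fun y => sq_incrCov_le y ha hb)
      (fun y hy => by simpa [abs_of_nonneg hy] using abs_mul_sq_incrCov_le y ha hb) hRN
  have hsub : Set.Icc (-(s * N)) ((T - s) * N - b) ⊆ Set.Icc (-(R * N)) (R * N) := by
    refine Set.Icc_subset_Icc ?_ ?_
    · have := mul_le_mul_of_nonneg_right hsR (by linarith : 0 ≤ N)
      linarith
    · have := mul_le_mul_of_nonneg_right (by linarith : T - s ≤ R) (by linarith : 0 ≤ N)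
      linarith
  have h1 : sqCovIntegral s T a b N ≤ ∫ y in Set.Icc (-(R * N)) (R * N), incrCov y a b ^ 2 :=
    setIntegral_mono_set ((continuous_sq_incrCov a b).integrableOn_Icc)
      (Eventually.of_forall fun _ => sq_nonneg _) hsub.eventuallyLE
  rw [integral_Icc_eq_integral_Ioc, ← intervalIntegral.integral_of_le (by linarith),
    ← intervalIntegral.integral_add_adjacent_intervals (b := 0)
      ((continuous_sq_incrCov a b).intervalIntegrable _ _)
      ((continuous_sq_incrCov a b).intervalIntegrable _ _), integral_sq_incrCov_neg] at h1
  have h2 := hb1 a b ha hb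
  have h3 := hb1 b a hb ha
  rw [Real.log_mul (by linarith) (by linarith)] at h2 h3
  rw [div_le_iff₀ (by linarith)]
  have e1 : b * a ^ 2 + a * b ^ 2 ≤ (1 + a ^ 2) * (1 + b ^ 2) := by
    nlinarith [mul_nonneg (sq_nonneg a) (sq_nonneg (b - 1)),
      mul_nonneg (sq_nonneg b) (sq_nonneg (a - 1)), sq_nonneg a, sq_nonneg b]
  have e2 : (a * b) ^ 2 ≤ (1 + a ^ 2) * (1 + b ^ 2) := by nlinarith [sq_nonneg a, sq_nonneg b]
  set Q := (1 + a ^ 2) * (1 + b ^ 2)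
  have hQ : 0 ≤ Q := by positivity
  have e3 : (a * b) ^ 2 * (Real.log R + Real.log N) ≤ Q * (Real.log R + Real.log N) :=
    mul_le_mul_of_nonneg_right e2 (by linarith)
  have e4 : 1 + Real.log R + Real.log N ≤ (2 + Real.log R) * Real.log N := by nlinarith
  have e5 := mul_le_mul_of_nonneg_left e4 hQ
  rw [mul_comm b a] at h3
  linarith

end SelfIntersection

/-! ### Change of variables -/

namespace SelfIntersection

/-- The pair of time intervals `[s, s + δ a]` and `[s + δ y, s + δ y + δ b]` with coordinates
`x = (((s, a), b), y)`, each interval being given by its endpoints. -/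
def intervalPair (δ : ℝ) (x : ((ℝ × ℝ) × ℝ) × ℝ) : (ℝ × ℝ) × (ℝ × ℝ) :=
  ((x.1.1.1, x.1.1.1 + δ * x.1.1.2),
    (x.1.1.1 + δ * x.2, x.1.1.1 + δ * x.2 + δ * x.1.2))

lemma continuous_intervalPair (δ : ℝ) : Continuous (intervalPair δ) := by
  unfold intervalPair
  fun_prop

lemma lintegral_add_mul {δ : ℝ} (hδ : 0 < δ) (c : ℝ) {f : ℝ → ℝ≥0∞} (hf : Measurable f) :
    ∫⁻ x, f x = ENNReal.ofReal δ * ∫⁻ v, f (c + δ * v) := by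
  have h := Real.smul_map_volume_mul_left hδ.ne'
  rw [abs_of_pos hδ] at h
  rw [← lintegral_add_left_eq_self f c]
  nth_rewrite 1 [← h]
  rw [lintegral_smul_measure, lintegral_map (by fun_prop) (by fun_prop), smul_eq_mul]

lemma smul_map_intervalPair {δ : ℝ} (hδ : 0 < δ) :
    ENNReal.ofReal (δ ^ 3) • Measure.map (intervalPair δ) volume = volume := by
  refine Measure.ext_of_lintegral _ fun f hf => ?_
  rw [lintegral_smul_measure, lintegral_map hf (continuous_intervalPair δ).measurable]
  have hp := (hf.comp (continuous_intervalPair δ).measurable).aemeasurable (μ := volume)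
  simp only [Measure.volume_eq_prod] at hp ⊢
  have hm := hf.comp (continuous_intervalPair δ).measurable
  rw [lintegral_prod _ hf.aemeasurable,
    lintegral_prod _ (hf.lintegral_prod_right' (ν := (volume : Measure ℝ).prod volume)).aemeasurable]
  have e1 : ∀ s : ℝ, ∫⁻ t : ℝ, ∫⁻ q : ℝ × ℝ, f ((s, t), q) ∂(volume.prod volume)
      = ENNReal.ofReal δ * ∫⁻ a, ∫⁻ q : ℝ × ℝ, f ((s, s + δ * a), q) ∂(volume.prod volume) :=
    fun s => lintegral_add_mul hδ s (f := fun t => ∫⁻ q : ℝ × ℝ, f ((s, t), q)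
      ∂(volume.prod volume)) (Measurable.lintegral_prod_right' (f := fun z : ℝ × (ℝ × ℝ) =>
        f ((s, z.1), z.2)) (by fun_prop))
  have e2 : ∀ s a : ℝ, ∫⁻ q : ℝ × ℝ, f ((s, s + δ * a), q) ∂(volume.prod volume)
      = ENNReal.ofReal δ * (ENNReal.ofReal δ *
        ∫⁻ b, ∫⁻ y, (f ∘ intervalPair δ) (((s, a), b), y)) := by
    intro s a
    rw [lintegral_prod _ (by fun_prop), lintegral_add_mul hδ s
      (Measurable.lintegral_prod_right' (f := fun z : ℝ × ℝ =>
        f ((s, s + δ * a), z)) (by fun_prop))]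
    have e3 : ∀ y : ℝ, ∫⁻ t : ℝ, f ((s, s + δ * a), (s + δ * y, t)) = ENNReal.ofReal δ *
        ∫⁻ b, (f ∘ intervalPair δ) (((s, a), b), y) :=
      fun y => lintegral_add_mul hδ (s + δ * y) (by fun_prop)
    simp_rw [e3]
    rw [lintegral_const_mul _ (Measurable.lintegral_prod_right' (f := fun z : ℝ × ℝ =>
        (f ∘ intervalPair δ) (((s, a), z.2), z.1)) (hm.comp (by fun_prop))),
      lintegral_lintegral_swap (f := fun y b => (f ∘ intervalPair δ) (((s, a), b), y))
        (hm.comp (by fun_prop : Measurable fun z : ℝ × ℝ =>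
          (((s, a), z.2), z.1))).aemeasurable]
  have hm2 : Measurable fun x : (ℝ × ℝ) × ℝ => ∫⁻ y, (f ∘ intervalPair δ) (x, y) :=
    hm.lintegral_prod_right'
  have hm3 : Measurable fun x : ℝ × ℝ => ∫⁻ b, ∫⁻ y, (f ∘ intervalPair δ) ((x, b), y) :=
    hm2.lintegral_prod_right'
  rw [lintegral_congr e1]
  simp_rw [e2]
  have e4 := lintegral_prod _ hp
  change _ • ∫⁻ x, (f ∘ intervalPair δ) x ∂_ = _
  rw [e4, lintegral_prod _ hm2.aemeasurable, lintegral_prod _ hm3.aemeasurable,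
    ENNReal.ofReal_pow hδ.le, smul_eq_mul, ← lintegral_const_mul _ hm3.lintegral_prod_right']
  refine lintegral_congr fun s => ?_
  have hm4 : Measurable fun a => ∫⁻ b, ∫⁻ y, (f ∘ intervalPair δ) (((s, a), b), y) :=
    hm3.comp (by fun_prop : Measurable fun a : ℝ => (s, a))
  rw [lintegral_const_mul _ (hm4.const_mul _), lintegral_const_mul _ hm4]
  ring

/-- Integration over pairs of time intervals in the coordinates of `intervalPair`. -/
lemma integral_eq_integral_intervalPair {δ : ℝ} (hδ : 0 < δ) {F : (ℝ × ℝ) × (ℝ × ℝ) → ℝ}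
    (hF : Integrable F) :
    Integrable (fun x : (ℝ × ℝ) × ℝ => ∫ y, F (intervalPair δ (x, y))) ∧
      ∫ z, F z = δ ^ 3 * ∫ x : (ℝ × ℝ) × ℝ, ∫ y, F (intervalPair δ (x, y)) := by
  have h := smul_map_intervalPair hδ
  have h0 : ENNReal.ofReal (δ ^ 3) ≠ 0 := by simp; positivity
  have hF' := hF
  rw [← h, integrable_smul_measure h0 (by simp)] at hF'
  have hc := (continuous_intervalPair δ).measurable.aemeasurable (μ := volume)
  have hi := (integrable_map_measure hF'.1 hc).1 hF'
  refine ⟨hi.integral_prod_left, ?_⟩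
  nth_rewrite 1 [← h]
  rw [integral_smul_measure, integral_map hc hF'.1, ENNReal.toReal_ofReal (by positivity),
    smul_eq_mul]
  congr 1
  exact integral_prod _ hi

end SelfIntersection

/-! ### Covariances in the second chaos -/

namespace SelfIntersection

lemma alpha_eq_ite {d : ℕ} (i j : Fin d) : alpha i j = if i = j then 1 else 0 := by
  have h2 : ∫ x : ℝ, x * x ∂(gaussianReal 0 1) = 1 := by
    have h := variance_eq_integral (μ := gaussianReal 0 1) (X := id) aemeasurable_id
    rw [variance_id_gaussianReal] at h
    simp only [id, integral_id_gaussianReal, sub_zero] at h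
    simpa [sq] using h.symm
  have e : ∀ x : Fin d → ℝ, x i * x j
      = ∏ k, ((if k = i then x k else 1) * if k = j then x k else 1) := fun x => by
    rw [Finset.prod_mul_distrib]
    simp
  unfold alpha
  simp_rw [e]
  rw [integral_fintype_prod_eq_prod (𝕜 := ℝ)
    (f := fun k y => (if k = i then y else 1) * if k = j then y else 1)]
  split_ifs with hij
  · subst hij
    refine Finset.prod_eq_one fun k _ => ?_
    split_ifs
    · exact h2
    · simp
  · refine Finset.prod_eq_zero (Finset.mem_univ i) ?_
    simp [hij, integral_id_gaussianReal]

variable {H : HurstIndex} {d : ℕ}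

lemma inner_indIcc (hH : (H : ℝ) = 3 / 4) (s t s' t' : ℝ≥0) :
    inner ℝ (indIcc H s t) (indIcc H s' t')
      = incrCov ((s' : ℝ) - s) ((t : ℝ) - s) ((t' : ℝ) - s') := by
  unfold indIcc incrCov
  rw [UniformSpace.Completion.inner_coe]
  simp only [inner_sub_left, inner_sub_right, StepFun.inner_ind_ind, fbmCov, hH]
  norm_num
  rw [abs_sub_comm (s : ℝ) s', abs_sub_comm (t : ℝ) t', abs_sub_comm (t : ℝ) s',
    abs_sub_comm (s : ℝ) t']
  ring_nf

lemma continuous_ind : Continuous (StepFun.ind : ℝ≥0 → StepFun H) := by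
  have h0 : (0 : ℝ) < H := H.2.1
  have hc : Continuous fun p : ℝ≥0 × ℝ≥0 => fbmCov H p.1 p.2 := by
    have h : Continuous fun x : ℝ => x ^ (2 * (H : ℝ)) := Real.continuous_rpow_const (by positivity)
    unfold fbmCov
    exact (((h.comp (by fun_prop)).add (h.comp (by fun_prop))).sub
      (h.comp (g := fun x : ℝ => x ^ (2 * (H : ℝ)))
        (f := fun p : ℝ≥0 × ℝ≥0 => |(p.1 : ℝ) - p.2|) (by fun_prop))).div_const 2
  rw [continuous_iff_continuousAt]
  intro s
  rw [ContinuousAt, tendsto_iff_norm_sub_tendsto_zero]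
  have e : ∀ t, ‖(StepFun.ind t : StepFun H) - StepFun.ind s‖
      = √(fbmCov H t t - fbmCov H t s - (fbmCov H s t - fbmCov H s s)) := fun t => by
    rw [norm_eq_sqrt_real_inner]
    simp only [inner_sub_left, inner_sub_right, StepFun.inner_ind_ind]
    congr 1
    ring
  simp_rw [e]
  have h1 : Continuous fun t : ℝ≥0 =>
      √(fbmCov H t t - fbmCov H t s - (fbmCov H s t - fbmCov H s s)) :=
    ((((hc.comp (Continuous.prodMk continuous_id continuous_id)).sub
      (hc.comp (Continuous.prodMk continuous_id continuous_const))).sub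
      ((hc.comp (Continuous.prodMk continuous_const continuous_id)).sub continuous_const))).sqrt
  have := h1.tendsto s
  simpa using this

lemma continuous_indIcc : Continuous fun p : ℝ≥0 × ℝ≥0 => indIcc H p.1 p.2 :=
  (UniformSpace.Completion.continuous_coe _).comp
    ((continuous_ind.comp continuous_snd).sub (continuous_ind.comp continuous_fst))

lemma continuous_tmul {E : Type*} [NormedAddCommGroup E] [InnerProductSpace ℝ E] :
    Continuous fun p : E × E => p.1 ⊗ₜ[ℝ] p.2 :=
  ((TensorProduct.mk ℝ E E).mkContinuous₂ 1 fun x y => by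
    simp [TensorProduct.norm_tmul]).continuous₂

/-- The set of pairs `(s, t)` with `0 ≤ s ≤ t ≤ T`. -/
def timeTriangle (T : ℝ) : Set (ℝ × ℝ) := {p | 0 ≤ p.1 ∧ p.1 ≤ p.2 ∧ p.2 ≤ T}

lemma isCompact_timeTriangle (T : ℝ) : IsCompact (timeTriangle T) := by
  refine (isCompact_Icc (a := (0 : ℝ)) (b := T)).prod (isCompact_Icc (a := (0 : ℝ)) (b := T))
    |>.of_isClosed_subset ?_ fun p hp => ⟨⟨hp.1, hp.2.1.trans hp.2.2⟩, ⟨hp.1.trans hp.2.1, hp.2.2⟩⟩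
  exact (isClosed_le continuous_const continuous_fst).inter
    ((isClosed_le continuous_fst continuous_snd).inter (isClosed_le continuous_snd continuous_const))

/-- The factor `(ε + u ^ (2 * H)) ^ (-d / 2 - 1)`, `2 * H = 3 / 2`, of the kernel. -/
noncomputable def kernelWeight (d : ℕ) (ε u : ℝ) : ℝ :=
  (ε + u ^ (3 / 2 : ℝ)) ^ (-(d : ℝ) / 2 - 1)

lemma continuousOn_kernelWeight {ε : ℝ} (hε : 0 < ε) :
    ContinuousOn (kernelWeight d ε) (Set.Ici 0) := by
  have h : Continuous fun u : ℝ => u ^ (3 / 2 : ℝ) := Real.continuous_rpow_const (by norm_num)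
  exact (continuous_const.add h).continuousOn.rpow_const fun u hu =>
    Or.inl (add_pos_of_pos_of_nonneg hε (Real.rpow_nonneg hu _)).ne'

/-- The algebraic tensor underlying `kernelF`; the factor `δ_{ij}` removes all mixed terms. -/
noncomputable def diagTensor (H : HurstIndex) (d : ℕ) (s t : ℝ≥0) :
    HSpacePow H d ⊗[ℝ] HSpacePow H d :=
  ∑ i : Fin d, PiLp.single 2 i (indIcc H s t) ⊗ₜ[ℝ] PiLp.single 2 i (indIcc H s t)

lemma kernelF_eq (hH : (H : ℝ) = 3 / 4) (ε : ℝ) (s t : ℝ≥0) :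
    kernelF H d ε s t = (-((2 * Real.pi) ^ (-(d : ℝ) / 2) / 2) * kernelWeight d ε ((t : ℝ) - s)) •
      ((diagTensor H d s t : HSpacePow H d ⊗[ℝ] HSpacePow H d) : HSpaceTensor H d) := by
  have hsum : ((diagTensor H d s t : HSpacePow H d ⊗[ℝ] HSpacePow H d) : HSpaceTensor H d)
      = ∑ i : Fin d, ((PiLp.single 2 i (indIcc H s t) ⊗ₜ[ℝ] PiLp.single 2 i (indIcc H s t) :
        HSpacePow H d ⊗[ℝ] HSpacePow H d) : HSpaceTensor H d) :=
    map_sum (UniformSpace.Completion.toCompl (α := HSpacePow H d ⊗[ℝ] HSpacePow H d)) _ _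
  rw [hsum, Finset.smul_sum]
  unfold kernelF
  refine Finset.sum_congr rfl fun i _ => ?_
  rw [Finset.sum_eq_single i]
  · rw [alpha_eq_ite, if_pos rfl, hH, kernelWeight]
    norm_num
  · intro j _ hj
    rw [alpha_eq_ite, if_neg hj.symm]
    simp
  · simp

lemma continuous_diagTensor : Continuous fun p : ℝ≥0 × ℝ≥0 => diagTensor H d p.1 p.2 := by
  unfold diagTensor
  refine continuous_finsetSum _ fun i _ => ?_
  have hs : Continuous fun x : HSpace H => (PiLp.single 2 i x : HSpacePow H d) :=
    Isometry.continuous (Isometry.of_dist_eq fun x y =>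
      PiLp.dist_single_same 2 (fun _ : Fin d => HSpace H) i x y)
  have h := hs.comp (continuous_indIcc (H := H))
  exact continuous_tmul.comp (h.prodMk h)

lemma integrableOn_kernelF (hH : (H : ℝ) = 3 / 4) {ε : ℝ} (hε : 0 < ε) (T : ℝ) :
    IntegrableOn (fun p : ℝ × ℝ => kernelF H d ε p.1.toNNReal p.2.toNNReal) (timeTriangle T) := by
  refine ContinuousOn.integrableOn_compact (isCompact_timeTriangle T) ?_
  simp only [kernelF_eq hH]
  have h1 : ContinuousOn (fun p : ℝ × ℝ => -((2 * Real.pi) ^ (-(d : ℝ) / 2) / 2) *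
      kernelWeight d ε ((p.2.toNNReal : ℝ) - p.1.toNNReal)) (timeTriangle T) := by
    refine continuousOn_const.mul ((continuousOn_kernelWeight hε).comp
      (Continuous.continuousOn (by fun_prop)) fun p hp => ?_)
    rw [Set.mem_Ici, sub_nonneg]
    exact_mod_cast Real.toNNReal_le_toNNReal hp.2.1
  exact h1.smul ((UniformSpace.Completion.continuous_coe _).comp (continuous_diagTensor.comp
    (continuous_real_toNNReal.prodMap continuous_real_toNNReal))).continuousOn

lemma inner_single_single (i j : Fin d) (x y : HSpace H) :
    inner ℝ (PiLp.single 2 i x : HSpacePow H d) (PiLp.single 2 j y)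
      = if i = j then inner ℝ x y else 0 := by
  rw [PiLp.inner_apply, Finset.sum_eq_single i]
  · split_ifs with h
    · subst h
      simp
    · rw [PiLp.single_eq_of_ne 2 h, inner_zero_right]
  · intro k _ hk
    rw [PiLp.single_eq_of_ne 2 hk, inner_zero_left]
  · simp

lemma inner_diagTensor (hH : (H : ℝ) = 3 / 4) (s t s' t' : ℝ≥0) :
    inner ℝ (diagTensor H d s t) (diagTensor H d s' t')
      = d * incrCov ((s' : ℝ) - s) ((t : ℝ) - s) ((t' : ℝ) - s') ^ 2 := by
  unfold diagTensor
  simp [sum_inner, inner_sum, TensorProduct.inner_tmul, inner_single_single, inner_indIcc hH, sq]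

variable {Ω : Type*} [MeasurableSpace Ω] {B : ℝ≥0 → Ω → EuclideanSpace ℝ (Fin d)} {P : Measure Ω}

lemma IsFBM.inner_I₂_kernelF (hB : IsFBM H B P) (hH : (H : ℝ) = 3 / 4) (ε : ℝ) (s t s' t' : ℝ≥0) :
    inner ℝ (hB.I₂ (kernelF H d ε s t)) (hB.I₂ (kernelF H d ε s' t'))
      = 2 * d * ((2 * Real.pi) ^ (-(d : ℝ) / 2) / 2) ^ 2 *
        (kernelWeight d ε ((t : ℝ) - s) * kernelWeight d ε ((t' : ℝ) - s') *
          incrCov ((s' : ℝ) - s) ((t : ℝ) - s) ((t' : ℝ) - s') ^ 2) := by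
  have hc : TensorProduct.comm ℝ _ _ (diagTensor H d s t) = diagTensor H d s t := by
    simp [diagTensor]
  rw [kernelF_eq hH, kernelF_eq hH, map_smul, map_smul, hB.I₂_coe, hB.I₂_coe, inner_smul_left,
    inner_smul_right, hB.inner_wickTensor, hc, inner_diagTensor hH]
  simp only [conj_trivial]
  ring

/-- The integrand of the covariance of the second chaos components, up to a constant, as a function
of the pair of time intervals. -/
noncomputable def covIntegrand (d : ℕ) (ε T₁ T₂ : ℝ) : (ℝ × ℝ) × (ℝ × ℝ) → ℝ :=
  (timeTriangle T₁ ×ˢ timeTriangle T₂).indicator fun z =>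
    kernelWeight d ε (z.1.2 - z.1.1) * kernelWeight d ε (z.2.2 - z.2.1) *
      incrCov (z.2.1 - z.1.1) (z.1.2 - z.1.1) (z.2.2 - z.2.1) ^ 2

lemma integrable_covIntegrand {ε : ℝ} (hε : 0 < ε) (T₁ T₂ : ℝ) :
    Integrable (covIntegrand d ε T₁ T₂) := by
  have hK := (isCompact_timeTriangle T₁).prod (isCompact_timeTriangle T₂)
  unfold covIntegrand
  rw [integrable_indicator_iff hK.isClosed.measurableSet]
  refine ContinuousOn.integrableOn_compact hK (ContinuousOn.mul (ContinuousOn.mul ?_ ?_) ?_)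
  · exact (continuousOn_kernelWeight hε).comp (Continuous.continuousOn (by fun_prop)) fun z hz =>
      sub_nonneg.2 hz.1.2.1
  · exact (continuousOn_kernelWeight hε).comp (Continuous.continuousOn (by fun_prop)) fun z hz =>
      sub_nonneg.2 hz.2.2.1
  · exact ((continuous_incrCov.comp (show Continuous fun z : (ℝ × ℝ) × (ℝ × ℝ) =>
      (z.2.1 - z.1.1, z.1.2 - z.1.1, z.2.2 - z.2.1) by fun_prop)).pow 2).continuousOn

lemma IsFBM.integral_I₂_kernelH_mul (hB : IsFBM H B P) (hH : (H : ℝ) = 3 / 4) {ε : ℝ} (hε : 0 < ε)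
    (T₁ T₂ : ℝ≥0) :
    ∫ ω, hB.I₂ (kernelH H d ε T₁) ω * hB.I₂ (kernelH H d ε T₂) ω ∂P
      = 2 * d * ((2 * Real.pi) ^ (-(d : ℝ) / 2) / 2) ^ 2 * ∫ z, covIntegrand d ε T₁ T₂ z := by
  have hi := fun T : ℝ≥0 => integrableOn_kernelF (d := d) hH hε T
  have hI : ∀ T : ℝ≥0, hB.I₂ (kernelH H d ε T)
      = ∫ p in timeTriangle T, hB.I₂ (kernelF H d ε p.1.toNNReal p.2.toNNReal) := fun T =>
    (hB.I₂.integral_comp_comm (hi T)).symm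
  have hi2 := fun T : ℝ≥0 => hB.I₂.integrable_comp (hi T)
  have hm : ∀ T, MeasurableSet (timeTriangle T) := fun T =>
    (isCompact_timeTriangle T).isClosed.measurableSet
  calc ∫ ω, hB.I₂ (kernelH H d ε T₁) ω * hB.I₂ (kernelH H d ε T₂) ω ∂P
      = inner ℝ (hB.I₂ (kernelH H d ε T₁)) (hB.I₂ (kernelH H d ε T₂)) := by
        rw [L2.inner_def]
        simp [mul_comm]
    _ = ∫ p in timeTriangle T₁, ∫ q in timeTriangle T₂,
          inner ℝ (hB.I₂ (kernelF H d ε p.1.toNNReal p.2.toNNReal))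
            (hB.I₂ (kernelF H d ε q.1.toNNReal q.2.toNNReal)) := by
        rw [hI T₁, real_inner_comm, ← integral_inner (hi2 T₁)]
        refine integral_congr_ae (Eventually.of_forall fun p => ?_)
        beta_reduce
        rw [real_inner_comm, hI T₂, ← integral_inner (hi2 T₂)]
    _ = ∫ p in timeTriangle T₁, ∫ q in timeTriangle T₂,
          2 * d * ((2 * Real.pi) ^ (-(d : ℝ) / 2) / 2) ^ 2 *
          (kernelWeight d ε (p.2 - p.1) * kernelWeight d ε (q.2 - q.1) *
            incrCov (q.1 - p.1) (p.2 - p.1) (q.2 - q.1) ^ 2) := by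
        refine setIntegral_congr_fun (hm _) fun p hp => setIntegral_congr_fun (hm _) fun q hq => ?_
        rw [hB.inner_I₂_kernelF hH, Real.coe_toNNReal _ hp.1, Real.coe_toNNReal _ hq.1,
          Real.coe_toNNReal _ (hp.1.trans hp.2.1), Real.coe_toNNReal _ (hq.1.trans hq.2.1)]
    _ = _ := by
        have hm2 := (hm T₁).prod (hm T₂)
        have h := integrable_covIntegrand (d := d) hε T₁ T₂
        unfold covIntegrand at h ⊢
        rw [integrable_indicator_iff hm2] at h
        rw [integral_indicator hm2, Measure.volume_eq_prod (α := ℝ × ℝ), setIntegral_prod _ h]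
        simp only [integral_const_mul]

end SelfIntersection

/-! ### The limit of the rescaled covariance -/

namespace SelfIntersection

variable {d : ℕ}

lemma kernelWeight_nonneg (d : ℕ) {ε u : ℝ} (hε : 0 ≤ ε) (hu : 0 ≤ u) : 0 ≤ kernelWeight d ε u :=
  Real.rpow_nonneg (add_nonneg hε (Real.rpow_nonneg hu _)) _

lemma kernelWeight_mul (d : ℕ) {δ u : ℝ} (hδ : 0 < δ) (hu : 0 ≤ u) :
    kernelWeight d (δ ^ (3 / 2 : ℝ)) (δ * u)
      = δ ^ (3 / 2 * (-(d : ℝ) / 2 - 1)) * kernelWeight d 1 u := by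
  have h := Real.rpow_nonneg hu (3 / 2)
  rw [kernelWeight, kernelWeight, Real.mul_rpow hδ.le hu, Real.rpow_mul hδ.le,
    ← Real.mul_rpow (Real.rpow_nonneg hδ.le _) (by positivity)]
  ring_nf

lemma integrableOn_kernelWeight_mul (hd : 3 ≤ d) :
    IntegrableOn (fun u => kernelWeight d 1 u * (1 + u ^ 2)) (Set.Ioi 0) := by
  have hd' : (3 : ℝ) ≤ d := by exact_mod_cast hd
  have hc : ContinuousOn (fun u => kernelWeight d 1 u * (1 + u ^ 2)) (Set.Ici 0) :=
    (continuousOn_kernelWeight one_pos).mul (by fun_prop)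
  rw [← Set.Ioc_union_Ioi_eq_Ioi (zero_le_one (α := ℝ)), integrableOn_union]
  constructor
  · exact ((hc.mono Set.Icc_subset_Ici_self).integrableOn_compact isCompact_Icc).mono_set
      Set.Ioc_subset_Icc_self
  · have hi : IntegrableOn (fun u : ℝ => 2 * u ^ (-(7 / 4) : ℝ)) (Set.Ioi 1) :=
      (integrableOn_Ioi_rpow_of_lt (by norm_num) one_pos).const_mul 2
    refine Integrable.mono' hi ((hc.mono fun u hu => ?_).aestronglyMeasurable measurableSet_Ioi) ?_
    · exact (zero_lt_one.trans (Set.mem_Ioi.1 hu)).le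
    refine (ae_restrict_mem measurableSet_Ioi).mono fun u hu => ?_
    have hu1 : 1 < u := hu
    have hu0 : 0 < u := by linarith
    have hk := kernelWeight_nonneg d zero_le_one hu0.le
    rw [Real.norm_of_nonneg (by positivity)]
    -- for `u ≥ 1` the weight is at most `u ^ (-15 / 4)`, the value of the bound at `d = 3`
    have h1 : kernelWeight d 1 u ≤ u ^ (-(15 / 4) : ℝ) := by
      have hp : 1 ≤ u ^ (3 / 2 : ℝ) := Real.one_le_rpow hu1.le (by norm_num)
      calc kernelWeight d 1 u ≤ (u ^ (3 / 2 : ℝ)) ^ (-(d : ℝ) / 2 - 1) :=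
            Real.rpow_le_rpow_of_nonpos (by positivity) (by linarith) (by linarith)
        _ ≤ (u ^ (3 / 2 : ℝ)) ^ (-(5 / 2) : ℝ) :=
            Real.rpow_le_rpow_of_exponent_le hp (by linarith)
        _ = u ^ (-(15 / 4) : ℝ) := by
            rw [← Real.rpow_mul hu0.le]
            norm_num
    have h2 : 1 + u ^ 2 ≤ 2 * u ^ 2 := by nlinarith
    calc kernelWeight d 1 u * (1 + u ^ 2) ≤ u ^ (-(15 / 4) : ℝ) * (2 * u ^ 2) := by gcongr
      _ = 2 * u ^ (-(7 / 4) : ℝ) := by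
          rw [← Real.rpow_natCast u 2, mul_left_comm, ← Real.rpow_add hu0]
          norm_num

lemma integrableOn_rhoIntegrand (hd : 3 ≤ d) : IntegrableOn (rhoIntegrand d) (Set.Ioi 0) := by
  have hc : ContinuousOn (fun u => kernelWeight d 1 u * u ^ 2) (Set.Ioi 0) :=
    ((continuousOn_kernelWeight one_pos).mul (by fun_prop)).mono Set.Ioi_subset_Ici_self
  refine Integrable.mono' (integrableOn_kernelWeight_mul hd)
    (hc.aestronglyMeasurable measurableSet_Ioi) ?_
  refine (ae_restrict_mem measurableSet_Ioi).mono fun u hu => ?_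
  have hk := kernelWeight_nonneg d zero_le_one (le_of_lt hu)
  change ‖kernelWeight d 1 u * u ^ 2‖ ≤ _
  rw [Real.norm_of_nonneg (by positivity)]
  exact mul_le_mul_of_nonneg_left (by linarith) hk

/-- The integrand that is left when time is measured in units of `1 / N`, `N = ε ^ (-2 / 3)`, and
the distance between the two intervals has been integrated out; `((s, a), b)` are the starting
point of the first interval and the rescaled lengths of both intervals. -/
noncomputable def rescaledIntegrand (d : ℕ) (T₁ T₂ N : ℝ) : (ℝ × ℝ) × ℝ → ℝ :=
  {x : (ℝ × ℝ) × ℝ | 0 ≤ x.1.1 ∧ 0 ≤ x.1.2 ∧ x.1.1 + N⁻¹ * x.1.2 ≤ T₁ ∧ 0 ≤ x.2}.indicator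
    fun x => kernelWeight d 1 x.1.2 * kernelWeight d 1 x.2 *
      sqCovIntegral x.1.1 T₂ x.1.2 x.2 N

/-- The self-similarity of the kernel weights and of `incrCov`, for `ε = (1 / N) ^ (3 / 2)`. -/
lemma integral_covIntegrand_intervalPair (d : ℕ) {N : ℝ} (hN : 0 < N) (T₁ T₂ : ℝ)
    (x : (ℝ × ℝ) × ℝ) :
    ∫ y, covIntegrand d (N⁻¹ ^ (3 / 2 : ℝ)) T₁ T₂ (intervalPair N⁻¹ (x, y))
      = N⁻¹ ^ (-(3 / 2 * d) : ℝ) * rescaledIntegrand d T₁ T₂ N x := by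
  obtain ⟨⟨s, a⟩, b⟩ := x
  set δ := N⁻¹ with hδN
  have hδ : 0 < δ := inv_pos.2 hN
  have hNδ : N = δ⁻¹ := by simp [hδN]
  by_cases hx : 0 ≤ s ∧ 0 ≤ a ∧ s + δ * a ≤ T₁ ∧ 0 ≤ b
  · obtain ⟨hs, ha, hT, hb⟩ := id hx
    have hδa : 0 ≤ δ * a := by positivity
    have hδb : 0 ≤ δ * b := by positivity
    rw [rescaledIntegrand, Set.indicator_of_mem (by exact hx)]
    simp only
    rw [sqCovIntegral, ← integral_indicator measurableSet_Icc, ← integral_const_mul,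
      ← integral_const_mul]
    refine integral_congr_ae (Eventually.of_forall fun y => ?_)
    have hiff : intervalPair δ (((s, a), b), y) ∈ timeTriangle T₁ ×ˢ timeTriangle T₂ ↔
        y ∈ Set.Icc (-(s * N)) ((T₂ - s) * N - b) := by
      have e1 : -(s * N) ≤ y ↔ 0 ≤ s + δ * y := by
        rw [hNδ, ← div_eq_mul_inv, ← neg_div, div_le_iff₀ hδ]
        constructor <;> intro h <;> linarith
      have e2 : y ≤ (T₂ - s) * N - b ↔ s + δ * y + δ * b ≤ T₂ := by
        rw [hNδ, ← div_eq_mul_inv, le_sub_iff_add_le, le_div_iff₀ hδ]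
        constructor <;> intro h <;> linarith
      rw [Set.mem_Icc, e1, e2]
      constructor
      · rintro ⟨-, h1, -, h3⟩
        exact ⟨h1, h3⟩
      · rintro ⟨h1, h3⟩
        exact ⟨⟨hs, by simpa [intervalPair] using hδa, hT⟩, h1,
          by simpa [intervalPair] using hδb, h3⟩
    simp only [covIntegrand]
    by_cases hy : y ∈ Set.Icc (-(s * N)) ((T₂ - s) * N - b)
    · rw [Set.indicator_of_mem (hiff.2 hy), Set.indicator_of_mem hy]
      simp only [intervalPair]
      rw [show s + δ * a - s = δ * a by ring, show s + δ * y - s = δ * y by ring,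
        show s + δ * y + δ * b - (s + δ * y) = δ * b by ring, kernelWeight_mul d hδ ha,
        kernelWeight_mul d hδ hb, incrCov_mul hδ.le]
      have e : δ ^ (-(3 / 2 * d) : ℝ) = δ ^ (3 / 2 * (-(d : ℝ) / 2 - 1)) *
          δ ^ (3 / 2 * (-(d : ℝ) / 2 - 1)) * (δ ^ (3 / 2 : ℝ)) ^ 2 := by
        rw [← Real.rpow_natCast (δ ^ (3 / 2 : ℝ)) 2, ← Real.rpow_mul hδ.le, ← Real.rpow_add hδ,
          ← Real.rpow_add hδ]
        congr 1
        push_cast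
        ring
      rw [e]
      ring
    · rw [Set.indicator_of_notMem (hiff.not.2 hy), Set.indicator_of_notMem hy]
      simp
  · rw [rescaledIntegrand, Set.indicator_of_notMem (by exact hx), mul_zero,
      ← integral_zero ℝ ℝ]
    refine integral_congr_ae (Eventually.of_forall fun y => Set.indicator_of_notMem ?_ _)
    rintro ⟨⟨h1, h2, h3⟩, -, h5, -⟩
    refine hx ⟨h1, ?_, h3, ?_⟩
    · simp only [intervalPair, le_add_iff_nonneg_right] at h2
      exact nonneg_of_mul_nonneg_right h2 hδ
    · simp only [intervalPair, le_add_iff_nonneg_right] at h5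
      exact nonneg_of_mul_nonneg_right h5 hδ

lemma integral_covIntegrand (d : ℕ) {N : ℝ} (hN : 0 < N) (T₁ T₂ : ℝ) :
    Integrable (rescaledIntegrand d T₁ T₂ N) ∧
      ∫ z, covIntegrand d (N⁻¹ ^ (3 / 2 : ℝ)) T₁ T₂ z
        = N⁻¹ ^ (3 - 3 / 2 * d : ℝ) * ∫ x, rescaledIntegrand d T₁ T₂ N x := by
  have hδ : 0 < N⁻¹ := inv_pos.2 hN
  obtain ⟨h1, h2⟩ := integral_eq_integral_intervalPair hδ
    (integrable_covIntegrand (d := d) (Real.rpow_pos_of_pos hδ (3 / 2)) T₁ T₂)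
  simp_rw [integral_covIntegrand_intervalPair d hN] at h1 h2
  refine ⟨(integrable_const_mul_iff (Real.rpow_pos_of_pos hδ _).ne'.isUnit _).1 h1, ?_⟩
  rw [h2, integral_const_mul, ← mul_assoc, ← Real.rpow_natCast _ 3, ← Real.rpow_add hδ]
  norm_num [sub_eq_add_neg]

lemma tendsto_rescaledIntegrand {T₁ T₂ s a b : ℝ} (hT₂ : 0 ≤ T₂) (h0 : s ≠ 0)
    (h1 : s ≠ T₁) (h2 : s ≠ T₂) :
    Tendsto (fun N => rescaledIntegrand d T₁ T₂ N ((s, a), b) / Real.log N) atTop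
      (𝓝 ((Set.Icc 0 (min T₁ T₂)).indicator 1 s * (Set.Ici 0).indicator (rhoIntegrand d) a *
        (9 / 32 * (Set.Ici 0).indicator (rhoIntegrand d) b))) := by
  unfold rescaledIntegrand
  by_cases hx : 0 ≤ s ∧ 0 ≤ a ∧ s ≤ T₁ ∧ 0 ≤ b
  · obtain ⟨hs, ha, hT, hb⟩ := hx
    have hev : ∀ᶠ N : ℝ in atTop, s + N⁻¹ * a ≤ T₁ := by
      have : Tendsto (fun N : ℝ => s + N⁻¹ * a) atTop (𝓝 (s + 0 * a)) :=
        tendsto_const_nhds.add (tendsto_inv_atTop_zero.mul_const a)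
      rw [zero_mul, add_zero] at this
      exact this.eventually_le_const (lt_of_le_of_ne hT h1)
    have hcongr : (fun N => kernelWeight d 1 a * kernelWeight d 1 b *
        (sqCovIntegral s T₂ a b N / Real.log N)) =ᶠ[atTop] fun N =>
        {x : (ℝ × ℝ) × ℝ | 0 ≤ x.1.1 ∧ 0 ≤ x.1.2 ∧ x.1.1 + N⁻¹ * x.1.2 ≤ T₁ ∧ 0 ≤ x.2}.indicator
          (fun x => kernelWeight d 1 x.1.2 * kernelWeight d 1 x.2 *
            sqCovIntegral x.1.1 T₂ x.1.2 x.2 N) ((s, a), b) / Real.log N := by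
      filter_upwards [hev] with N hN
      rw [Set.indicator_of_mem (by exact ⟨hs, ha, hN, hb⟩), mul_div_assoc]
    refine Tendsto.congr' hcongr ?_
    rw [Set.indicator_of_mem (Set.mem_Ici.2 ha), Set.indicator_of_mem (Set.mem_Ici.2 hb)]
    rcases lt_or_gt_of_ne h2 with h | h
    · rw [Set.indicator_of_mem (Set.mem_Icc.2 ⟨hs, le_min hT h.le⟩)]
      have := (tendsto_sqCovIntegral_of_lt (lt_of_le_of_ne hs h0.symm) h ha hb).const_mul
        (kernelWeight d 1 a * kernelWeight d 1 b)
      refine this.trans (Eq.le ?_)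
      congr 1
      change _ = 1 * (kernelWeight d 1 a * a ^ 2) * (9 / 32 * (kernelWeight d 1 b * b ^ 2))
      ring
    · rw [Set.indicator_of_notMem fun hmem => absurd (hmem.2.trans (min_le_right _ _)) (not_le.2 h)]
      have := (tendsto_sqCovIntegral_of_gt hT₂ h ha hb).const_mul
        (kernelWeight d 1 a * kernelWeight d 1 b)
      simpa using this
  · have hlim : (Set.Icc 0 (min T₁ T₂)).indicator 1 s * (Set.Ici 0).indicator (rhoIntegrand d) a *
        (9 / 32 * (Set.Ici 0).indicator (rhoIntegrand d) b) = 0 := by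
      by_contra hne
      refine hx ⟨?_, ?_, ?_, ?_⟩
      all_goals
        by_contra hc
        simp [Set.indicator, hc] at hne
    rw [hlim]
    refine tendsto_const_nhds.congr' ?_
    filter_upwards [eventually_gt_atTop 0] with N hN
    rw [Set.indicator_of_notMem, zero_div]
    rintro ⟨g1, g2, g3, g4⟩
    refine hx ⟨g1, g2, ?_, g4⟩
    have : 0 ≤ N⁻¹ * a := mul_nonneg (inv_nonneg.2 hN.le) g2
    simp only at g3
    linarith

lemma tendsto_integral_rescaledIntegrand (hd : 3 ≤ d) {T₁ T₂ : ℝ} (hT₁ : 0 ≤ T₁) (hT₂ : 0 ≤ T₂) :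
    Tendsto (fun N => ∫ x, rescaledIntegrand d T₁ T₂ N x / Real.log N) atTop
      (𝓝 (9 / 32 * (∫ u in Set.Ioi (0 : ℝ), rhoIntegrand d u) ^ 2 * min T₁ T₂)) := by
  have hlimval : ∫ x : (ℝ × ℝ) × ℝ, (Set.Icc 0 (min T₁ T₂)).indicator 1 x.1.1 *
        (Set.Ici 0).indicator (rhoIntegrand d) x.1.2 *
        (9 / 32 * (Set.Ici 0).indicator (rhoIntegrand d) x.2)
      = 9 / 32 * (∫ u in Set.Ioi (0 : ℝ), rhoIntegrand d u) ^ 2 * min T₁ T₂ := by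
    have e1 := integral_prod_mul (μ := (volume : Measure (ℝ × ℝ))) (ν := (volume : Measure ℝ))
      (fun p : ℝ × ℝ => (Set.Icc 0 (min T₁ T₂)).indicator (1 : ℝ → ℝ) p.1 *
        (Set.Ici 0).indicator (rhoIntegrand d) p.2)
      (fun b => 9 / 32 * (Set.Ici 0).indicator (rhoIntegrand d) b)
    have e2 := integral_prod_mul (μ := (volume : Measure ℝ)) (ν := (volume : Measure ℝ))
      ((Set.Icc 0 (min T₁ T₂)).indicator (1 : ℝ → ℝ)) ((Set.Ici 0).indicator (rhoIntegrand d))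
    rw [← Measure.volume_eq_prod] at e1 e2
    rw [e1, e2, integral_const_mul, integral_indicator measurableSet_Ici,
      integral_Ici_eq_integral_Ioi, integral_indicator_one measurableSet_Icc,
      Real.volume_real_Icc_of_le (le_min hT₁ hT₂)]
    ring
  rw [← hlimval]
  set g : ℝ → ℝ := (Set.Ici 0).indicator fun u => kernelWeight d 1 u * (1 + u ^ 2) with hg
  have hgi : Integrable g := by
    rw [hg, integrable_indicator_iff measurableSet_Ici, integrableOn_Ici_iff_integrableOn_Ioi]
    exact integrableOn_kernelWeight_mul hd
  have hgn : ∀ u, 0 ≤ g u := fun u => Set.indicator_nonneg (fun u hu =>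
    mul_nonneg (kernelWeight_nonneg d zero_le_one hu) (by positivity)) u
  have hone : Integrable ((Set.Icc 0 T₁).indicator (1 : ℝ → ℝ)) :=
    (integrable_indicator_iff measurableSet_Icc).2 (integrableOn_const (by simp))
  set R : ℝ := max 1 (max T₁ T₂) with hR
  set C : ℝ := 9 / 2 * (2 + Real.log R) with hC
  have hR1 : 1 ≤ R := le_max_left _ _
  have hC0 : 0 ≤ C := by
    have := Real.log_nonneg hR1
    positivity
  refine tendsto_integral_filter_of_dominated_convergence
    (fun x => (Set.Icc 0 T₁).indicator 1 x.1.1 * g x.1.2 * (C * g x.2)) ?_ ?_ ?_ ?_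
  · filter_upwards [eventually_gt_atTop 0] with N hN
    exact ((integral_covIntegrand d hN T₁ T₂).1.div_const _).aestronglyMeasurable
  · filter_upwards [eventually_ge_atTop (Real.exp 1)] with N hN
    refine Eventually.of_forall fun x => ?_
    have hN1 : 1 ≤ N := le_trans (by linarith [Real.add_one_le_exp (1 : ℝ)]) hN
    have hind : 0 ≤ (Set.Icc 0 T₁).indicator (1 : ℝ → ℝ) x.1.1 :=
      Set.indicator_nonneg (fun _ _ => zero_le_one) _
    unfold rescaledIntegrand
    by_cases hx : 0 ≤ x.1.1 ∧ 0 ≤ x.1.2 ∧ x.1.1 + N⁻¹ * x.1.2 ≤ T₁ ∧ 0 ≤ x.2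
    · rw [Set.indicator_of_mem (by exact hx)]
      obtain ⟨hs, ha, hT, hb⟩ := hx
      have hsT : x.1.1 ≤ T₁ := by
        have : 0 ≤ N⁻¹ * x.1.2 := mul_nonneg (inv_nonneg.2 (by linarith)) ha
        linarith
      have hk1 := kernelWeight_nonneg d zero_le_one ha
      have hk2 := kernelWeight_nonneg d zero_le_one hb
      have hq := sqCovIntegral_nonneg x.1.1 T₂ x.1.2 x.2 N
      have hl := Real.log_nonneg hN1
      rw [Real.norm_of_nonneg (by positivity), hg, Set.indicator_of_mem (Set.mem_Icc.2 ⟨hs, hsT⟩),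
        Set.indicator_of_mem (Set.mem_Ici.2 ha), Set.indicator_of_mem (Set.mem_Ici.2 hb),
        mul_div_assoc]
      have hle := sqCovIntegral_div_log_le hR1
        (hsT.trans ((le_max_left _ _).trans (le_max_right _ _))) hs
        ((le_max_right T₁ T₂).trans (le_max_right _ _)) ha hb hN
      refine (mul_le_mul_of_nonneg_left hle (mul_nonneg hk1 hk2)).trans_eq ?_
      simp only [Pi.one_apply]
      ring
    · rw [Set.indicator_of_notMem (by exact hx), zero_div, norm_zero]
      exact mul_nonneg (mul_nonneg hind (hgn _)) (mul_nonneg hC0 (hgn _))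
  · exact (hone.mul_prod hgi).mul_prod (hgi.const_mul C)
  · -- the pointwise limit can fail at `s = 0`, `s = T₁` and `s = T₂`, which form a null set
    have hqmp : Measure.QuasiMeasurePreserving (fun x : (ℝ × ℝ) × ℝ => x.1.1) volume volume :=
      Measure.quasiMeasurePreserving_fst.comp Measure.quasiMeasurePreserving_fst
    have hne : ∀ c : ℝ, ∀ᵐ x : (ℝ × ℝ) × ℝ, x.1.1 ≠ c := fun c =>
      hqmp.ae (Measure.ae_ne volume c)
    filter_upwards [hne 0, hne T₁, hne T₂] with x h0 h1 h2
    exact tendsto_rescaledIntegrand hT₂ h0 h1 h2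

lemma sq_rho_eq (d : ℕ) : rho d ^ 2 = 2 * d * ((2 * Real.pi) ^ (-(d : ℝ) / 2) / 2) ^ 2 * (2 / 3) *
    (9 / 32 * (∫ u in Set.Ioi (0 : ℝ), rhoIntegrand d u) ^ 2) := by
  have hpi := Real.pi_pos
  have e1 : ((2 * Real.pi) ^ (-(d : ℝ) / 2)) ^ 2 = ((2 : ℝ) ^ d * Real.pi ^ d)⁻¹ := by
    rw [← Real.rpow_natCast _ 2, ← Real.rpow_mul (by positivity),
      show -(d : ℝ) / 2 * (2 : ℕ) = -(d : ℝ) by push_cast; ring, Real.rpow_neg (by positivity),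
      Real.rpow_natCast, mul_pow]
  have e2 : ((2 : ℝ) ^ (((d : ℝ) + 5) / 2)) ^ 2 = 2 ^ d * 32 := by
    rw [← Real.rpow_natCast _ 2, ← Real.rpow_mul (by positivity),
      show ((d : ℝ) + 5) / 2 * (2 : ℕ) = (d : ℝ) + (5 : ℕ) by push_cast; ring,
      Real.rpow_add (by norm_num), Real.rpow_natCast, Real.rpow_natCast]
    norm_num
  have e3 : (Real.pi ^ ((d : ℝ) / 2)) ^ 2 = Real.pi ^ d := by
    rw [← Real.rpow_natCast _ 2, ← Real.rpow_mul (by positivity),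
      show (d : ℝ) / 2 * (2 : ℕ) = (d : ℝ) by push_cast; ring, Real.rpow_natCast]
  rw [rho, mul_pow, div_pow, mul_pow, Real.sq_sqrt (by positivity), e2, e3, div_pow, e1]
  field_simp
  ring

end SelfIntersection

open SelfIntersection
theorem theorem3p5 {Ω : Type*} [MeasurableSpace Ω] (P : Measure Ω) [IsProbabilityMeasure P]
    (d : ℕ) (hd : 3 ≤ d) (H : SelfIntersection.HurstIndex) (hH : (H : ℝ) = 3 / 4)
    (B : ℝ≥0 → Ω → EuclideanSpace ℝ (Fin d)) (hB : SelfIntersection.IsFBM H B P) :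
    IntegrableOn (SelfIntersection.rhoIntegrand d) (Set.Ioi 0) ∧
    ∀ T₁ T₂ : ℝ≥0,
      Tendsto
        (fun ε : ℝ => ε ^ ((d : ℝ) - 2) / Real.log (1 / ε)
          * ∫ ω, hB.I₂ (SelfIntersection.kernelH H d ε T₁) ω
              * hB.I₂ (SelfIntersection.kernelH H d ε T₂) ω ∂P)
        (𝓝[>] 0) (𝓝 (SelfIntersection.rho d ^ 2 * min (T₁ : ℝ) T₂)) := by
  refine ⟨integrableOn_rhoIntegrand hd, fun T₁ T₂ => ?_⟩
  have hN : Tendsto (fun ε : ℝ => (ε ^ (2 / 3 : ℝ))⁻¹) (𝓝[>] 0) atTop := by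
    refine ((tendsto_rpow_atTop (by norm_num : (0 : ℝ) < 2 / 3)).comp
      tendsto_inv_nhdsGT_zero).congr' ?_
    filter_upwards [self_mem_nhdsWithin] with ε hε
    exact Real.inv_rpow (le_of_lt hε) _
  have hlim := ((tendsto_integral_rescaledIntegrand hd T₁.coe_nonneg T₂.coe_nonneg).comp
    hN).const_mul (2 * d * ((2 * Real.pi) ^ (-(d : ℝ) / 2) / 2) ^ 2 * (2 / 3))
  rw [← mul_assoc _ _ (min (T₁ : ℝ) T₂), ← sq_rho_eq] at hlim
  refine hlim.congr' ?_
  filter_upwards [self_mem_nhdsWithin] with ε hε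
  have hε0 : 0 < ε := hε
  have hδ : 0 < ε ^ (2 / 3 : ℝ) := Real.rpow_pos_of_pos hε0 _
  have hc := (integral_covIntegrand d (inv_pos.2 hδ) T₁ T₂).2
  have e1 : (ε ^ (2 / 3 : ℝ)) ^ (3 / 2 : ℝ) = ε := by
    rw [← Real.rpow_mul hε0.le]
    norm_num
  have e2 : (ε ^ (2 / 3 : ℝ)) ^ (3 - 3 / 2 * d : ℝ) = (ε ^ ((d : ℝ) - 2))⁻¹ := by
    rw [← Real.rpow_mul hε0.le, ← Real.rpow_neg hε0.le]
    ring_nf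
  rw [inv_inv, e1, e2] at hc
  have e3 : Real.log (1 / ε) = 3 / 2 * Real.log (ε ^ (2 / 3 : ℝ))⁻¹ := by
    rw [Real.log_inv, Real.log_rpow hε0, one_div, Real.log_inv]
    ring
  have hp := Real.rpow_pos_of_pos hε0 ((d : ℝ) - 2)
  rw [hB.integral_I₂_kernelH_mul hH hε0, hc, e3]
  simp only [Function.comp]
  rw [integral_div]
  field_simp
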